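/- Let $\gamma\in(0,2)$ and let $J:\mathbb Z\to\mathbb R_+$ satisfy $\sum_{x\in\mathbb Z}J(x)=1$ and $J(x)=\varphi(|x|)(1+|x|)^{-(1+\gamma)}$ for all $x\in\mathbb Z$, where $\varphi:[0,\infty)\to(0,\infty)$ is slowly varying, i.e. measurable with $\lim_{x\to\infty}\varphi(cx)/\varphi(x)=1$ for every $c>0$; assume also that $J(x)$ is a non-increasing function of $|x|$. Let $W=(W_t)_{t\ge 0}$ be the (càdlàg) continuous-time random walk on $\mathbb Z$ started at $0$ with jump rate $1$ and transition kernel $J$, i.e. the Markov chain with generator $\mathcal Lf(x)=\sum_{y\in\mathbb Z}J(y)\,(f(x+y)-f(x))$. Let $W^{(1)},W^{(2)}$ be independent copies of $W$ and, for $\rho\in[0,1)$, put $X_t=W^{(1)}_{(1-\rho)t}$ and $Y_t=W^{(2)}_{\rho t}$; write $\mathbf E$ for the expectation with respect to $X$ (with $Y$ fixed) and $\mathbb P,\mathbb E$ for the law of $Y$ and its expectation. For $T>0$ and $\beta\ge 0$ set $$H_T^Y(X)=\int_0^T\mathbf 1_{\{X_t=Y_t\}}\,dt,\qquad Z^{Y}_{\beta,T}=\mathbf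 E\big[e^{\beta H^Y_T(X)}\big],\qquad Z^{Y,\mathtt c}_{\beta,T}=\beta\,\mathbf E\big[e^{\beta H^Y_T(X)}\mathbf 1_{\{X_T=Y_T\}}\big].$$ **Proposition (existence of the quenched free energy, $\gamma$-stable walks).** For every $\rho\in[0,1)$ and $\beta\ge0$ there is a deterministic constant $\mathtt F(\rho,\beta)\in[0,\infty)$, depending only on $J$, $\rho$ and $\beta$, such that for every $T>0$ the variable $Z^Y_{\beta,T}$ is positive with $\mathbb P$-integrable logarithm, and, as $T\to\infty$ along the reals, $$\frac1T\log Z^{Y}_{\beta,T}\longrightarrow \mathtt F(\rho,\beta)\quad \mathbb P\text{-almost surely and in }L^1(\mathbb P),\qquad \frac1T\,\mathbb E\big[\log Z^{Y}_{\beta,T}\big]\longrightarrow\mathtt F(\rho,\beta).$$ If moreover $\beta>0$, the same holds, with the same limit $\mathtt F(\rho,\beta)$, when $Z^{Y}_{\beta,T}$ is replaced by $Z^{Y,\mathtt c}_{\beta,T}$. -/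

import Mathlib

open MeasureTheory ProbabilityTheory Filter Topology
open scoped NNReal

noncomputable section

namespace RWPM

/-- `φ` is a positive slowly varying function on `[0, ∞)`: it is measurable, positive, and
`φ (c x) / φ x → 1` as `x → ∞` for every `c > 0`. (Values at negative reals play no role.) -/
structure IsSlowlyVarying (φ : ℝ → ℝ) : Prop where
  measurable : Measurable φ
  pos : ∀ x : ℝ, 0 ≤ x → 0 < φ x
  tendsto_ratio : ∀ c : ℝ, 0 < c → Tendsto (fun x : ℝ => φ (c * x) / φ x) atTop (𝓝 1)

/-- The jump kernel of a `γ`-stable walk on `ℤ`: a probability kernel of the form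
`J x = φ(|x|) (1 + |x|) ^ (-(1 + γ))` with `φ` positive and slowly varying, which is unimodal
(`J x` is a non-increasing function of `|x|`). Such a `J` is nonnegative and symmetric. -/
structure IsStableKernel (γ : ℝ) (J : ℤ → ℝ) : Prop where
  exists_slowlyVarying : ∃ φ : ℝ → ℝ, IsSlowlyVarying φ ∧
    ∀ x : ℤ, J x = φ |(x : ℝ)| * (1 + |(x : ℝ)|) ^ (-(1 + γ))
  hasSum_one : HasSum J 1
  unimodal : ∀ x y : ℤ, |x| ≤ |y| → J y ≤ J x

/-- The `n`-fold convolution power `J^{*n}`: the law of the sum of `n` independent steps of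
law `J`. -/
def convPow (J : ℤ → ℝ) : ℕ → ℤ → ℝ
  | 0 => fun x => if x = 0 then 1 else 0
  | n + 1 => fun x => ∑' y : ℤ, J y * convPow J n (x - y)

/-- The transition probabilities `p_t(x) = ∑ₙ e^{-t} tⁿ / n! J^{*n}(x)` of the continuous-time
random walk with transition kernel `J` and jump rate `1`, i.e. the kernel of the semigroup
`e^{t 𝓛}` with generator `𝓛 f(x) = ∑_y J(y) (f(x + y) - f(x))`. -/
def transitionProb (J : ℤ → ℝ) (t : ℝ) (x : ℤ) : ℝ :=
  ∑' n : ℕ, Real.exp (-t) * t ^ n / (n.factorial : ℝ) * convPow J n x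

/-- `W` is (a version of) the continuous-time random walk on `ℤ` with transition kernel `J` and
jump rate `1`, started from `0`: its paths are right-continuous with left limits (so they are
step functions), and it has independent stationary increments with law `p_t`. -/
structure IsRandomWalk {Ω : Type*} [MeasurableSpace Ω] (J : ℤ → ℝ) (W : ℝ≥0 → Ω → ℤ)
    (P : Measure Ω) : Prop where
  measurable : ∀ t : ℝ≥0, Measurable (W t)
  zero : ∀ ω : Ω, W 0 ω = 0
  right_continuous : ∀ (ω : Ω) (t : ℝ≥0), ContinuousWithinAt (fun s => W s ω) (Set.Ici t) t
  left_limits : ∀ (ω : Ω) (t : ℝ≥0), ∃ l : ℤ, Tendsto (fun s => W s ω) (𝓝[<] t) (𝓝 l)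
  indep_increments : HasIndepIncrements W P
  law_increments : ∀ (s t : ℝ≥0) (x : ℤ),
    P.real {ω | W (s + t) ω - W s ω = x} = transitionProb J (t : ℝ) x

/-- The walk slowed down to jump rate `r`: `t ↦ W_{r t}` (used for `r ≥ 0` and `t ≥ 0`). -/
def slowed {Ω : Type*} (r : ℝ) (W : ℝ≥0 → Ω → ℤ) (t : ℝ) (ω : Ω) : ℤ :=
  W (r * t).toNNReal ω

/-- The energy `H_T^y(x) = ∫_0^T 1_{x_t = y_t} dt` of two trajectories. -/
def overlap (x y : ℝ → ℤ) (T : ℝ) : ℝ :=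
  ∫ t in (0 : ℝ)..T, if x t = y t then (1 : ℝ) else 0

/-- The free partition function `Z_{β,T}^y = E[exp(β H_T^y(X))]`, for a fixed trajectory `y`;
the expectation is over `X` only. -/
def freePartition {Ω : Type*} [MeasurableSpace Ω] (P : Measure Ω) (X : ℝ → Ω → ℤ) (β : ℝ)
    (y : ℝ → ℤ) (T : ℝ) : ℝ :=
  ∫ ω, Real.exp (β * overlap (fun t => X t ω) y T) ∂P

/-- The constrained partition function
`Z_{β,T}^{y,c} = β E[exp(β H_T^y(X)) 1_{X_T = y_T}]`, for a fixed trajectory `y`. -/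
def constrainedPartition {Ω : Type*} [MeasurableSpace Ω] (P : Measure Ω) (X : ℝ → Ω → ℤ) (β : ℝ)
    (y : ℝ → ℤ) (T : ℝ) : ℝ :=
  β * ∫ ω, Real.exp (β * overlap (fun t => X t ω) y T) *
    (if X T ω = y T then (1 : ℝ) else 0) ∂P

/-- For a family `Z_T` (`T > 0`) of random variables on `(Ω, Q)`: every `Z_T` is positive with
integrable logarithm, and, as `T → ∞` along the reals, `T⁻¹ log Z_T` converges to the constant
`F` almost surely and in `L¹(Q)`, and `T⁻¹ E[log Z_T]` converges to `F`. -/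
structure HasFreeEnergy {Ω : Type*} [MeasurableSpace Ω] (Q : Measure Ω) (Z : ℝ → Ω → ℝ)
    (F : ℝ) : Prop where
  pos : ∀ T : ℝ, 0 < T → ∀ ω : Ω, 0 < Z T ω
  integrable_log : ∀ T : ℝ, 0 < T → Integrable (fun ω => Real.log (Z T ω)) Q
  tendsto_ae : ∀ᵐ ω ∂Q, Tendsto (fun T : ℝ => T⁻¹ * Real.log (Z T ω)) atTop (𝓝 F)
  tendsto_L1 : Tendsto (fun T : ℝ => ∫ ω, |T⁻¹ * Real.log (Z T ω) - F| ∂Q) atTop (𝓝 0)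
  tendsto_mean : Tendsto (fun T : ℝ => T⁻¹ * ∫ ω, Real.log (Z T ω) ∂Q) atTop (𝓝 F)

end RWPM

end

/-! The free energy is trapped between a subadditive and a superadditive quantity. Taking the
supremum of the free partition function over the starting point of `X` (`freeSup`) makes it
submultiplicative when time intervals are concatenated (`freeSup_add_le`); requiring `X` and `Y` to
agree at the end (`pinned`) makes it supermultiplicative, because both walks then restart from a
common site (`mul_pinned_le`). The free partition function lies between the two, and the constrained
one is `β` times the pinned one.

Cut `[0, T]` into blocks of length `k`. The block terms are functions of disjoint stretches of `Y`,
hence i.i.d., and the ordinary strong law takes the place of a subadditive ergodic theorem: almost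
surely `T⁻¹ logFree` has limsup at most `k⁻¹ E[logFree_k]` (`ae_limsup_le`), and `T⁻¹ logPinned` has
liminf at least `k⁻¹ E[logPinned_k]` (`ae_le_liminf`). It remains to see that the two means agree to
leading order.

For this, write `exp(βH)` as `1` plus an integral over meeting times. Used once to start at a
meeting and once to end at one, this bounds `freeSup` by `(1 + βT)²` times a bound for pinned
partition functions of subintervals (`freeSup_le_of_pinned`). A pinned stretch extends to a longer
interval at the price of two transition probabilities of `X`, evaluated at displacements of `Y`.
That price is polynomial in time and in the running maximum of `|Y|`: one has `J x ≥ c (1 + |x|)⁻⁴`,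
and at time `t` the walk `X` is at polynomial distance with probability at least one half
(`exists_kernelLowerBound`). Since `Y` has a finite moment of order `γ/4`, the logarithm of its
maximum has mean `O(log T)` and is almost surely `o(T)`. Thus the two means differ by `O(log T)`, up
to a time lag of 2 (`exists_integral_logFree_le`).

The `L¹` statement follows from the almost sure and mean limits, as positive parts are bounded. The
limit depends only on `J`, `ρ`, `β` because transition probabilities determine the law of a walk on
the path space `Traj` (`IsWalkLaw.unique`). -/

noncomputable section

namespace RWPM

open scoped ENNReal

/-! ### Polynomial bounds on the jump kernel -/

/-- A positive sequence whose consecutive ratios converge to `L` is bounded below by a geometric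
sequence of any ratio `r < L`. -/
lemma exists_geometric_le {a : ℕ → ℝ} (ha : ∀ k, 0 < a k) {L r : ℝ} (hr : 0 < r) (hrL : r < L)
    (h : Tendsto (fun k => a (k + 1) / a k) atTop (𝓝 L)) :
    ∃ c : ℝ, 0 < c ∧ ∀ k, c * r ^ k ≤ a k := by
  obtain ⟨N, hN⟩ := eventually_atTop.1 (h.eventually (lt_mem_nhds hrL))
  -- Beyond `N` the ratios exceed `r`, so the constant only has to serve the finitely many `k ≤ N`.
  obtain ⟨m, -, hm⟩ := Finset.exists_min_image (Finset.range (N + 1)) (fun k => a k / r ^ k)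
    ⟨0, by simp⟩
  refine ⟨a m / r ^ m, div_pos (ha m) (pow_pos hr m), fun k => ?_⟩
  have key : ∀ j, a m / r ^ m * r ^ (N + j) ≤ a (N + j) := by
    intro j
    induction j with
    | zero =>
      have := hm N (by simp)
      rw [le_div_iff₀ (pow_pos hr N)] at this
      simpa using this
    | succ j ih =>
      have h1 := hN (N + j) (by omega)
      rw [lt_div_iff₀ (ha _)] at h1
      calc a m / r ^ m * r ^ (N + (j + 1)) = r * (a m / r ^ m * r ^ (N + j)) := by
            rw [← add_assoc, pow_succ]; ring
        _ ≤ r * a (N + j) := by gcongr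
        _ ≤ a (N + (j + 1)) := h1.le
  rcases le_total k N with hk | hk
  · have := hm k (by simp; omega)
    rwa [le_div_iff₀ (pow_pos hr k)] at this
  · obtain ⟨j, rfl⟩ := Nat.exists_eq_add_of_le hk
    exact key j

/-- A positive sequence whose consecutive ratios converge to `L > 0` is bounded above by a
geometric sequence of any ratio `r > L`. -/
lemma exists_le_geometric {a : ℕ → ℝ} (ha : ∀ k, 0 < a k) {L r : ℝ} (hL : 0 < L) (hrL : L < r)
    (h : Tendsto (fun k => a (k + 1) / a k) atTop (𝓝 L)) :
    ∃ C : ℝ, 0 < C ∧ ∀ k, a k ≤ C * r ^ k := by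
  have hr : 0 < r := hL.trans hrL
  obtain ⟨c, hc, hca⟩ := exists_geometric_le (a := fun k => (a k)⁻¹) (L := L⁻¹) (r := r⁻¹)
    (fun k => inv_pos.2 (ha k)) (inv_pos.2 hr) ((inv_lt_inv₀ hr hL).2 hrL) (by
      refine (h.inv₀ hL.ne').congr fun k => ?_
      rw [inv_div, div_eq_mul_inv, div_eq_mul_inv, inv_inv, mul_comm])
  refine ⟨c⁻¹, inv_pos.2 hc, fun k => ?_⟩
  have := hca k
  rw [inv_pow, ← div_eq_mul_inv] at this
  rw [le_inv_comm₀ (div_pos hc (pow_pos hr k)) (ha k), inv_div] at this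
  rwa [inv_mul_eq_div]

namespace IsStableKernel

variable {γ : ℝ} {J : ℤ → ℝ}

lemma pos (hJ : IsStableKernel γ J) (x : ℤ) : 0 < J x := by
  obtain ⟨φ, hφ, h⟩ := hJ.exists_slowlyVarying
  rw [h]
  have := hφ.pos _ (abs_nonneg (x : ℝ))
  positivity

/-- Slow variation enters only here, with dilation factor 2. Unimodality then interpolates between
dyadic points, so no uniform convergence theorem for slowly varying functions is needed. -/
lemma tendsto_dyadic_ratio (hJ : IsStableKernel γ J) :
    Tendsto (fun k : ℕ => J (2 ^ (k + 1)) / J (2 ^ k)) atTop (𝓝 ((2 : ℝ) ^ (-(1 + γ)))) := by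
  obtain ⟨φ, hφ, h⟩ := hJ.exists_slowlyVarying
  have h2 : Tendsto (fun k : ℕ => (2 : ℝ) ^ k) atTop atTop :=
    tendsto_pow_atTop_atTop_of_one_lt one_lt_two
  have h3 := (hφ.tendsto_ratio 2 two_pos).comp h2
  have h4 : Tendsto (fun k : ℕ => (1 + 2 * (2 : ℝ) ^ k) / (1 + (2 : ℝ) ^ k)) atTop (𝓝 2) := by
    have : Tendsto (fun k : ℕ => 2 - (1 + (2 : ℝ) ^ k)⁻¹) atTop (𝓝 (2 - 0)) :=
      tendsto_const_nhds.sub (tendsto_const_nhds.add_atTop h2).inv_tendsto_atTop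
    rw [sub_zero] at this
    refine this.congr fun k => ?_
    have : (1 + (2 : ℝ) ^ k) ≠ 0 := by positivity
    field_simp
    ring
  have h5 := h3.mul (h4.rpow_const (p := -(1 + γ)) (Or.inl two_ne_zero))
  rw [one_mul] at h5
  refine h5.congr fun k => ?_
  have e1 : |(((2 : ℤ) ^ (k + 1) : ℤ) : ℝ)| = 2 * 2 ^ k := by
    push_cast; rw [abs_of_pos (by positivity), pow_succ]; ring
  have e2 : |(((2 : ℤ) ^ k : ℤ) : ℝ)| = 2 ^ k := by
    push_cast; rw [abs_of_pos (by positivity)]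
  rw [h, h, e1, e2, Real.div_rpow (by positivity) (by positivity)]
  simp only [Function.comp]
  rw [div_mul_div_comm]

/-- The dyadic scale of an integer. -/
lemma exists_dyadic (x : ℤ) :
    ∃ k : ℕ, |x| ≤ 2 ^ (k + 1) ∧ (2 : ℝ) ^ k ≤ 1 + |(x : ℝ)| ∧ |(x : ℝ)| ≤ 2 * 2 ^ k ∧
      (x ≠ 0 → (2 : ℤ) ^ k ≤ |x|) := by
  refine ⟨Nat.log 2 x.natAbs, ?_, ?_, ?_, ?_⟩
  · have := (Nat.lt_pow_succ_log_self one_lt_two x.natAbs).le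
    rw [Int.abs_eq_natAbs]
    exact_mod_cast this
  · rw [← Int.cast_abs, Int.abs_eq_natAbs]
    have : 2 ^ Nat.log 2 x.natAbs ≤ 1 + x.natAbs := by
      rcases eq_or_ne x.natAbs 0 with h | h
      · simp [h]
      · exact (Nat.pow_log_le_self 2 h).trans (by omega)
    exact_mod_cast this
  · have := (Nat.lt_pow_succ_log_self one_lt_two x.natAbs).le
    rw [← Int.cast_abs, Int.abs_eq_natAbs, mul_comm, ← pow_succ]
    exact_mod_cast this
  · intro hx
    have := Nat.pow_log_le_self 2 (Int.natAbs_ne_zero.2 hx)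
    rw [Int.abs_eq_natAbs]
    exact_mod_cast this

/-- As `γ < 2`, the dyadic ratio `2 ^ (-(1 + γ))` exceeds `2 ^ (-4)`; the exponent 4 is a convenient
integer above `1 + γ`. -/
lemma exists_polynomial_le (hJ : IsStableKernel γ J) (hγ₂ : γ < 2) :
    ∃ c : ℝ, 0 < c ∧ ∀ x : ℤ, c * ((1 + |(x : ℝ)|) ^ 4)⁻¹ ≤ J x := by
  have hL : (1 / 16 : ℝ) < 2 ^ (-(1 + γ)) := by
    have : (1 / 16 : ℝ) = 2 ^ (-4 : ℝ) := by
      rw [Real.rpow_neg (by norm_num)]; norm_num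
    rw [this]
    exact Real.rpow_lt_rpow_of_exponent_lt one_lt_two (by linarith)
  obtain ⟨c, hc, hca⟩ := exists_geometric_le (a := fun k => J (2 ^ k)) (fun k => hJ.pos _)
    (by norm_num : (0 : ℝ) < 1 / 16) hL hJ.tendsto_dyadic_ratio
  -- Unimodality compares `x` with the dyadic point above it, one scale further; this costs the
  -- factor 16.
  refine ⟨c / 16, by positivity, fun x => ?_⟩
  obtain ⟨k, h1, h2, -, -⟩ := exists_dyadic x
  calc c / 16 * ((1 + |(x : ℝ)|) ^ 4)⁻¹ ≤ c / 16 * (((2 : ℝ) ^ k) ^ 4)⁻¹ := by gcongr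
    _ = c * (1 / 16) ^ (k + 1) := by
      have : ((2 : ℝ) ^ k) ^ 4 = 16 ^ k := by rw [← pow_mul, mul_comm k 4, pow_mul]; norm_num
      rw [this, pow_succ, one_div, inv_pow]; ring
    _ ≤ J (2 ^ (k + 1)) := hca (k + 1)
    _ ≤ J x := hJ.unimodal _ _ (by rwa [abs_of_pos (by positivity : (0 : ℤ) < 2 ^ (k + 1))])

/-- The exponent `1 + γ` is lowered to `1 + γ/2` to absorb the slowly varying factor. Multiplying by
`|x| ^ (γ/4)` leaves the summable exponent `1 + γ/4`. -/
lemma summable_moment (hJ : IsStableKernel γ J) (hγ₀ : 0 < γ) :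
    Summable fun x : ℤ => J x * |(x : ℝ)| ^ (γ / 4) := by
  set θ : ℝ := 2 ^ (-(1 + γ / 2)) with hθ
  obtain ⟨C, hC, hCa⟩ := exists_le_geometric (a := fun k => J (2 ^ k)) (fun k => hJ.pos _)
    (by positivity) (Real.rpow_lt_rpow_of_exponent_lt one_lt_two (by linarith) :
      (2 : ℝ) ^ (-(1 + γ)) < θ) hJ.tendsto_dyadic_ratio
  refine Summable.of_nonneg_of_le (fun x => mul_nonneg (hJ.pos x).le (by positivity)) (fun x => ?_)
    ((Real.summable_abs_int_rpow (b := 1 + γ / 4) (by linarith)).mul_left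
      (C * 2 ^ (1 + γ / 2)))
  rcases eq_or_ne x 0 with rfl | hx
  · have h1 : γ / 4 ≠ 0 := by positivity
    have h2 : 0 ≤ C * 2 ^ (1 + γ / 2) * |((0 : ℤ) : ℝ)| ^ (-(1 + γ / 4)) := by positivity
    simpa [Real.zero_rpow h1] using h2
  have hx' : 0 < |(x : ℝ)| := abs_pos.2 (Int.cast_ne_zero.2 hx)
  obtain ⟨k, -, -, h3, h4⟩ := exists_dyadic x
  have h5 : J x ≤ C * 2 ^ (1 + γ / 2) * |(x : ℝ)| ^ (-(1 + γ / 2)) := by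
    calc J x ≤ J (2 ^ k) := hJ.unimodal _ _ (by
          rw [abs_of_pos (by positivity : (0 : ℤ) < 2 ^ k)]; exact h4 hx)
      _ ≤ C * θ ^ k := hCa k
      _ = C * ((2 : ℝ) ^ k) ^ (-(1 + γ / 2)) := by
        rw [hθ, ← Real.rpow_natCast, ← Real.rpow_natCast, ← Real.rpow_mul two_pos.le,
          ← Real.rpow_mul two_pos.le, mul_comm (k : ℝ)]
      _ ≤ C * (|(x : ℝ)| / 2) ^ (-(1 + γ / 2)) := by
        refine mul_le_mul_of_nonneg_left ?_ hC.le
        exact Real.rpow_le_rpow_of_nonpos (by positivity) (by linarith) (by linarith)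
      _ = _ := by
        rw [Real.div_rpow (abs_nonneg _) two_pos.le, Real.rpow_neg two_pos.le]
        field_simp
  calc J x * |(x : ℝ)| ^ (γ / 4)
      ≤ C * 2 ^ (1 + γ / 2) * |(x : ℝ)| ^ (-(1 + γ / 2)) * |(x : ℝ)| ^ (γ / 4) := by gcongr
    _ = C * 2 ^ (1 + γ / 2) * |(x : ℝ)| ^ (-(1 + γ / 4)) := by
      rw [mul_assoc, ← Real.rpow_add hx']; congr 2; ring

end IsStableKernel

/-! ### Convolution powers and transition probabilities -/

section Kernel

variable {J : ℤ → ℝ}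

lemma convPow_mem (hJ : ∀ x, 0 ≤ J x) (h1 : HasSum J 1) (n : ℕ) (x : ℤ) :
    0 ≤ convPow J n x ∧ convPow J n x ≤ 1 := by
  induction n generalizing x with
  | zero => by_cases h : x = 0 <;> simp [convPow, h]
  | succ n ih =>
    refine ⟨tsum_nonneg fun y => mul_nonneg (hJ y) (ih _).1, ?_⟩
    rw [← h1.tsum_eq]
    have hle : ∀ y, J y * convPow J n (x - y) ≤ J y := fun y =>
      mul_le_of_le_one_right (hJ y) (ih _).2
    exact Summable.tsum_le_tsum hle
      (Summable.of_nonneg_of_le (fun y => mul_nonneg (hJ y) (ih _).1) hle h1.summable) h1.summable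

lemma convPow_one (x : ℤ) : convPow J 1 x = J x := by
  simp only [convPow]
  rw [tsum_eq_single x]
  · simp
  · intro y hy
    rw [if_neg (sub_ne_zero.2 hy.symm), mul_zero]

lemma ofReal_convPow_succ_le (hJ : ∀ x, 0 ≤ J x) (h1 : HasSum J 1) (n : ℕ) (x : ℤ) :
    ENNReal.ofReal (convPow J (n + 1) x) ≤
      ∑' y : ℤ, ENNReal.ofReal (J y) * ENNReal.ofReal (convPow J n (x - y)) := by
  simp only [convPow]
  rw [ENNReal.ofReal_tsum_of_nonneg (fun y => mul_nonneg (hJ y) (convPow_mem hJ h1 n _).1)]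
  · exact le_of_eq (tsum_congr fun y => ENNReal.ofReal_mul (hJ y))
  · exact Summable.of_nonneg_of_le (fun y => mul_nonneg (hJ y) (convPow_mem hJ h1 n _).1)
      (fun y => mul_le_of_le_one_right (hJ y) (convPow_mem hJ h1 n _).2) h1.summable

lemma tsum_ofReal_kernel (hJ : ∀ x, 0 ≤ J x) (h1 : HasSum J 1) :
    ∑' x : ℤ, ENNReal.ofReal (J x) = 1 := by
  rw [← ENNReal.ofReal_tsum_of_nonneg hJ h1.summable, h1.tsum_eq, ENNReal.ofReal_one]

/-- Conditioning on one step, by Tonelli; this drives the inductions on the number of steps for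
total mass and for moments, where upper bounds suffice. -/
lemma tsum_mul_convPow_succ_le (hJ : ∀ x, 0 ≤ J x) (h1 : HasSum J 1) (w : ℤ → ℝ≥0∞) (n : ℕ) :
    ∑' x : ℤ, w x * ENNReal.ofReal (convPow J (n + 1) x) ≤
      ∑' y : ℤ, ENNReal.ofReal (J y) *
        ∑' z : ℤ, w (z + y) * ENNReal.ofReal (convPow J n z) := by
  calc ∑' x : ℤ, w x * ENNReal.ofReal (convPow J (n + 1) x)
      ≤ ∑' x : ℤ, w x * ∑' y : ℤ, ENNReal.ofReal (J y) *
          ENNReal.ofReal (convPow J n (x - y)) := by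
        gcongr with x; exact ofReal_convPow_succ_le hJ h1 n x
    _ = ∑' x : ℤ, ∑' y : ℤ, ENNReal.ofReal (J y) *
          (w x * ENNReal.ofReal (convPow J n (x - y))) := by
        refine tsum_congr fun x => ?_
        rw [← ENNReal.tsum_mul_left]
        exact tsum_congr fun y => by ring
    _ = ∑' y : ℤ, ENNReal.ofReal (J y) *
          ∑' x : ℤ, w x * ENNReal.ofReal (convPow J n (x - y)) := by
        rw [ENNReal.tsum_comm]
        exact tsum_congr fun y => ENNReal.tsum_mul_left
    _ = _ := by
        refine tsum_congr fun y => ?_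
        congr 1
        rw [← (Equiv.addRight y).tsum_eq]
        exact tsum_congr fun z => by simp

lemma tsum_ofReal_convPow_le (hJ : ∀ x, 0 ≤ J x) (h1 : HasSum J 1) (n : ℕ) :
    ∑' x : ℤ, ENNReal.ofReal (convPow J n x) ≤ 1 := by
  induction n with
  | zero =>
    rw [tsum_eq_single 0]
    · simp [convPow]
    · intro x hx; simp [convPow, hx]
  | succ n ih =>
    have := tsum_mul_convPow_succ_le hJ h1 (fun _ => 1) n
    simp only [one_mul] at this
    refine this.trans ?_
    rw [ENNReal.tsum_mul_right, tsum_ofReal_kernel hJ h1, one_mul]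
    exact ih

/-- A subadditive weight has a moment under `J^{*n}` at most `n` times its moment under `J`. -/
lemma tsum_mul_convPow_le (hJ : ∀ x, 0 ≤ J x) (h1 : HasSum J 1) {w : ℤ → ℝ≥0∞}
    (hw0 : w 0 = 0) (hw : ∀ x y, w (x + y) ≤ w x + w y) (n : ℕ) :
    ∑' x : ℤ, w x * ENNReal.ofReal (convPow J n x) ≤
      n * ∑' x : ℤ, w x * ENNReal.ofReal (J x) := by
  induction n with
  | zero =>
    rw [tsum_eq_single 0]
    · simp [hw0]
    · intro x hx; simp [convPow, hx]
  | succ n ih =>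
    refine (tsum_mul_convPow_succ_le hJ h1 w n).trans ?_
    calc ∑' y : ℤ, ENNReal.ofReal (J y) * ∑' z : ℤ, w (z + y) * ENNReal.ofReal (convPow J n z)
        ≤ ∑' y : ℤ, ENNReal.ofReal (J y) *
            (n * (∑' x : ℤ, w x * ENNReal.ofReal (J x)) + w y) := by
          gcongr with y
          calc ∑' z : ℤ, w (z + y) * ENNReal.ofReal (convPow J n z)
              ≤ ∑' z : ℤ, (w z * ENNReal.ofReal (convPow J n z) +
                  w y * ENNReal.ofReal (convPow J n z)) := by
                gcongr with z
                rw [← add_mul]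
                gcongr
                exact hw z y
            _ ≤ _ := by
                rw [ENNReal.tsum_add, ENNReal.tsum_mul_left]
                gcongr
                exact mul_le_of_le_one_right' (tsum_ofReal_convPow_le hJ h1 n)
      _ = _ := by
          simp_rw [mul_add]
          rw [ENNReal.tsum_add, ENNReal.tsum_mul_right, tsum_ofReal_kernel hJ h1, one_mul]
          push_cast
          rw [add_mul, one_mul]
          congr 1
          exact tsum_congr fun y => mul_comm _ _

lemma poisson_nonneg {t : ℝ} (ht : 0 ≤ t) (n : ℕ) :
    0 ≤ Real.exp (-t) * t ^ n / (n.factorial : ℝ) := by positivity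

lemma hasSum_poisson (t : ℝ) :
    HasSum (fun n : ℕ => Real.exp (-t) * t ^ n / (n.factorial : ℝ)) 1 := by
  have h := (NormedSpace.expSeries_div_hasSum_exp t).mul_left (Real.exp (-t))
  rw [← Real.exp_eq_exp_ℝ, ← Real.exp_add, neg_add_cancel, Real.exp_zero] at h
  simpa only [mul_div_assoc] using h

lemma tsum_ofReal_poisson_mul {t : ℝ} (ht : 0 ≤ t) :
    ∑' n : ℕ, ENNReal.ofReal (Real.exp (-t) * t ^ n / (n.factorial : ℝ)) * n =
      ENNReal.ofReal t := by
  rw [tsum_eq_zero_add' ENNReal.summable]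
  simp only [Nat.cast_zero, mul_zero, zero_add]
  have : ∀ n : ℕ, ENNReal.ofReal (Real.exp (-t) * t ^ (n + 1) / ((n + 1).factorial : ℝ)) *
      ((n + 1 : ℕ) : ℝ≥0∞) = ENNReal.ofReal t *
        ENNReal.ofReal (Real.exp (-t) * t ^ n / (n.factorial : ℝ)) := by
    intro n
    rw [← ENNReal.ofReal_natCast, ← ENNReal.ofReal_mul (poisson_nonneg ht _),
      ← ENNReal.ofReal_mul ht]
    congr 1
    rw [Nat.factorial_succ]
    push_cast
    have : (n.factorial : ℝ) ≠ 0 := by positivity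
    field_simp
    ring
  rw [tsum_congr this, ENNReal.tsum_mul_left,
    ← ENNReal.ofReal_tsum_of_nonneg (poisson_nonneg ht) (hasSum_poisson t).summable,
    (hasSum_poisson t).tsum_eq, ENNReal.ofReal_one, mul_one]

lemma summable_transitionProb (hJ : ∀ x, 0 ≤ J x) (h1 : HasSum J 1) {t : ℝ} (ht : 0 ≤ t) (x : ℤ) :
    Summable fun n : ℕ => Real.exp (-t) * t ^ n / (n.factorial : ℝ) * convPow J n x :=
  Summable.of_nonneg_of_le
    (fun n => mul_nonneg (poisson_nonneg ht n) (convPow_mem hJ h1 n x).1)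
    (fun n => mul_le_of_le_one_right (poisson_nonneg ht n) (convPow_mem hJ h1 n x).2)
    (hasSum_poisson t).summable

/-- The walk reaches `x` at time `t` by a single jump. -/
lemma le_transitionProb (hJ : ∀ x, 0 ≤ J x) (h1 : HasSum J 1) {t : ℝ} (ht : 0 ≤ t) (x : ℤ) :
    Real.exp (-t) * t * J x ≤ transitionProb J t x := by
  have := (summable_transitionProb hJ h1 ht x).le_tsum 1
    (fun n _ => mul_nonneg (poisson_nonneg ht n) (convPow_mem hJ h1 n x).1)
  simpa [convPow_one, transitionProb] using this

/-- A subadditive weight has a moment under `p_t` at most `t` times its moment under `J`. -/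
lemma tsum_mul_transitionProb_le (hJ : ∀ x, 0 ≤ J x) (h1 : HasSum J 1) {w : ℤ → ℝ≥0∞}
    (hw0 : w 0 = 0) (hw : ∀ x y, w (x + y) ≤ w x + w y) {t : ℝ} (ht : 0 ≤ t) :
    ∑' x : ℤ, w x * ENNReal.ofReal (transitionProb J t x) ≤
      ENNReal.ofReal t * ∑' x : ℤ, w x * ENNReal.ofReal (J x) := by
  have h : ∀ x, w x * ENNReal.ofReal (transitionProb J t x) = ∑' n : ℕ,
      ENNReal.ofReal (Real.exp (-t) * t ^ n / (n.factorial : ℝ)) *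
        (w x * ENNReal.ofReal (convPow J n x)) := by
    intro x
    rw [transitionProb, ENNReal.ofReal_tsum_of_nonneg
      (fun n => mul_nonneg (poisson_nonneg ht n) (convPow_mem hJ h1 n x).1)
      (summable_transitionProb hJ h1 ht x), ← ENNReal.tsum_mul_left]
    refine tsum_congr fun n => ?_
    rw [ENNReal.ofReal_mul (poisson_nonneg ht n)]
    ring
  rw [tsum_congr h, ENNReal.tsum_comm, ← tsum_ofReal_poisson_mul ht, ← ENNReal.tsum_mul_right]
  gcongr with n
  rw [ENNReal.tsum_mul_left, mul_assoc]
  gcongr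
  exact tsum_mul_convPow_le hJ h1 hw0 hw n

end Kernel

/-! ### Path space: joint measurability, shifting and stopping -/

/-- Right-continuous integer-valued trajectories that vanish up to time `0`, with the
`σ`-algebra generated by the coordinates. -/
structure Traj where
  /-- The position at time `t`. -/
  toFun : ℝ → ℤ
  apply_nonpos' : ∀ t ≤ 0, toFun t = 0
  rightCont : ∀ t, ContinuousWithinAt toFun (Set.Ici t) t

namespace Traj

instance : CoeFun Traj (fun _ => ℝ → ℤ) := ⟨toFun⟩

instance : MeasurableSpace Traj := MeasurableSpace.comap toFun inferInstance

lemma apply_nonpos (x : Traj) {t : ℝ} (ht : t ≤ 0) : x t = 0 := x.apply_nonpos' t ht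

@[ext] lemma ext {x y : Traj} (h : ∀ t, x t = y t) : x = y := by
  cases x; cases y; simpa using funext h

lemma measurable_coe : Measurable toFun := comap_measurable _

lemma measurable_eval (t : ℝ) : Measurable (fun x : Traj => x t) :=
  (measurable_pi_apply t).comp measurable_coe

lemma measurable_of_eval {α : Type*} [MeasurableSpace α] {f : α → Traj}
    (h : ∀ t, Measurable fun a => f a t) : Measurable f :=
  measurable_comap_iff.2 (measurable_pi_lambda _ h)

/-- Right-continuous trajectories are pointwise limits of their discretisations from the right. -/
lemma tendsto_ceil (x : Traj) (t : ℝ) :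
    Tendsto (fun n : ℕ => x ((⌈t * (n + 1 : ℝ)⌉ : ℝ) / (n + 1))) atTop (𝓝 (x t)) := by
  refine (x.rightCont t).tendsto.comp (tendsto_nhdsWithin_iff.2 ⟨?_, ?_⟩)
  · refine tendsto_of_tendsto_of_tendsto_of_le_of_le (g := fun _ => t)
      (h := fun n : ℕ => t + 1 / ((n : ℝ) + 1)) tendsto_const_nhds ?_ ?_ ?_
    · simpa using tendsto_const_nhds.add (tendsto_one_div_add_atTop_nhds_zero_nat (𝕜 := ℝ))
    · intro n
      have : (0 : ℝ) < n + 1 := by positivity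
      simp only
      rw [le_div_iff₀ this]
      exact Int.le_ceil _
    · intro n
      have : (0 : ℝ) < n + 1 := by positivity
      simp only
      rw [div_le_iff₀ this, add_mul, one_div_mul_cancel this.ne']
      exact (Int.ceil_lt_add_one _).le
  · refine Eventually.of_forall fun n => ?_
    have : (0 : ℝ) < n + 1 := by positivity
    rw [Set.mem_Ici, le_div_iff₀ this]
    exact Int.le_ceil _

/-- Right-continuity makes evaluation a limit of evaluations at grid times; each of these depends on
time only through an integer, so it is jointly measurable. -/
lemma measurable_uncurry : Measurable (fun p : ℝ × Traj => p.2 p.1) := by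
  refine measurable_of_tendsto_metrizable
    (f := fun (n : ℕ) (p : ℝ × Traj) => p.2 ((⌈p.1 * (n + 1 : ℝ)⌉ : ℝ) / (n + 1)))
    (fun n => ?_) (tendsto_pi_nhds.2 fun p => tendsto_ceil p.2 p.1)
  have h : Measurable (fun q : ℤ × Traj => q.2 ((q.1 : ℝ) / (n + 1))) :=
    measurable_from_prod_countable_right fun k => measurable_eval ((k : ℝ) / (n + 1))
  exact h.comp ((Int.measurable_ceil.comp (measurable_fst.mul_const _)).prodMk measurable_snd)

/-- The trajectory `t ↦ x (s + t) - x s` after time `s`. -/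
def shift (s : ℝ) (x : Traj) : Traj :=
  ⟨fun t => x (s + max t 0) - x s, fun t ht => by simp [max_eq_right ht], fun t => by
    refine ContinuousWithinAt.sub ?_ continuousWithinAt_const
    refine (x.rightCont _).comp (t := Set.Ici (s + max t 0)) (by fun_prop) ?_
    intro u hu
    have : t ≤ u := hu
    simp only [Set.mem_Ici]
    gcongr⟩

/-- The trajectory stopped at time `s`. -/
def stopAt (s : ℝ) (x : Traj) : Traj :=
  ⟨fun t => x (min t s), fun t ht => x.apply_nonpos ((min_le_left _ _).trans ht), fun t => by
    refine (x.rightCont _).comp (t := Set.Ici (min t s)) (by fun_prop) ?_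
    intro u hu
    have : t ≤ u := hu
    simp only [Set.mem_Ici]
    gcongr⟩

lemma shift_apply (s : ℝ) (x : Traj) {t : ℝ} (ht : 0 ≤ t) : shift s x t = x (s + t) - x s := by
  change x (s + max t 0) - x s = _
  rw [max_eq_left ht]

lemma stopAt_apply (s : ℝ) (x : Traj) (t : ℝ) : stopAt s x t = x (min t s) := rfl

lemma stopAt_apply_of_le {s : ℝ} (x : Traj) {t : ℝ} (ht : t ≤ s) : stopAt s x t = x t := by
  rw [stopAt_apply, min_eq_left ht]

lemma measurable_shift (s : ℝ) : Measurable (shift s) :=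
  measurable_of_eval fun _ => (measurable_eval _).sub (measurable_eval _)

lemma measurable_stopAt (s : ℝ) : Measurable (stopAt s) :=
  measurable_of_eval fun _ => measurable_eval _

lemma ext_nonneg {x y : Traj} (h : ∀ t, 0 ≤ t → x t = y t) : x = y := by
  ext t
  rcases le_total t 0 with ht | ht
  · rw [x.apply_nonpos ht, y.apply_nonpos ht]
  · exact h t ht

lemma shift_zero (x : Traj) : shift 0 x = x := by
  refine ext_nonneg fun t ht => ?_
  rw [shift_apply _ _ ht, zero_add, x.apply_nonpos le_rfl, sub_zero]

lemma shift_shift {s t : ℝ} (ht : 0 ≤ t) (x : Traj) : shift t (shift s x) = shift (s + t) x := by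
  refine ext_nonneg fun u hu => ?_
  rw [shift_apply _ _ hu, shift_apply _ _ hu, shift_apply _ _ ht, shift_apply _ _ (by positivity),
    add_assoc]
  ring

lemma stopAt_shift {s t : ℝ} (ht : 0 ≤ t) (x : Traj) :
    stopAt t (shift s x) = shift s (stopAt (s + t) x) := by
  refine ext_nonneg fun u hu => ?_
  rw [stopAt_apply, shift_apply _ _ hu, shift_apply _ _ (le_min hu ht), stopAt_apply, stopAt_apply,
    min_eq_left (by linarith : s ≤ s + t), min_add_add_left]

lemma stopAt_stopAt {s t : ℝ} (hst : s ≤ t) (x : Traj) : stopAt s (stopAt t x) = stopAt s x := by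
  ext u
  simp only [stopAt_apply, min_assoc, min_eq_left hst]

end Traj

open Traj

/-! ### Laws of walks on path space: uniqueness and the Markov property -/

lemma indepFun_map {α β δ ε : Type*} [MeasurableSpace α] [MeasurableSpace β] [MeasurableSpace δ]
    [MeasurableSpace ε] {μ : Measure α} {φ : α → β} (hφ : Measurable φ) {f : β → δ} {g : β → ε}
    (hf : Measurable f) (hg : Measurable g) (h : IndepFun (f ∘ φ) (g ∘ φ) μ) :
    IndepFun f g (μ.map φ) := by
  rw [indepFun_iff_measure_inter_preimage_eq_mul] at h ⊢
  intro s t hs ht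
  rw [Measure.map_apply hφ ((hf hs).inter (hg ht)), Measure.map_apply hφ (hf hs),
    Measure.map_apply hφ (hg ht)]
  exact h s t hs ht

/-- `μ` is the law of a process with independent stationary increments of law `κ`. -/
structure IsWalkLaw (κ : ℝ → ℤ → ℝ) (μ : Measure Traj) : Prop where
  isProbabilityMeasure : IsProbabilityMeasure μ
  indepFun : ∀ s : ℝ, 0 ≤ s → IndepFun (stopAt s) (shift s) μ
  increment : ∀ s t : ℝ, 0 ≤ s → 0 ≤ t → ∀ z : ℤ, μ.real {x | x (s + t) - x s = z} = κ t z

namespace IsWalkLaw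

variable {κ : ℝ → ℤ → ℝ} {μ ν : Measure Traj}

lemma map_shift (h : IsWalkLaw κ μ) {s : ℝ} (hs : 0 ≤ s) : IsWalkLaw κ (μ.map (shift s)) := by
  have := h.isProbabilityMeasure
  refine ⟨Measure.isProbabilityMeasure_map (measurable_shift s).aemeasurable, fun t ht => ?_,
    fun t u ht hu z => ?_⟩
  · refine indepFun_map (measurable_shift s) (measurable_stopAt t) (measurable_shift t) ?_
    have h1 := (h.indepFun (s + t) (by positivity)).comp (measurable_shift s) measurable_id
    refine h1.congr ?_ ?_ <;> refine Eventually.of_forall fun x => ?_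
    · simp [stopAt_shift ht]
    · simp [shift_shift ht]
  · have hm : MeasurableSet {x : Traj | x (t + u) - x t = z} :=
      ((measurable_eval (t + u)).sub (measurable_eval t)) (measurableSet_singleton z)
    rw [map_measureReal_apply (measurable_shift s) hm, ← h.increment (s + t) u (by positivity) hu z]
    congr 1
    ext x
    simp only [Set.mem_preimage, Set.mem_ofPred_eq]
    rw [shift_apply _ _ (by positivity), shift_apply _ _ ht, ← add_assoc]
    simp

/-- Induction on the number of times, for all pairs of walk laws at once. The smallest time `m`
splits the cylinder into an event at `m` and a cylinder for the path shifted by `m`; these are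
independent, and the shifted laws are walk laws with the same `κ`. -/
lemma measure_cylinder_eq (hμ : IsWalkLaw κ μ) (hν : IsWalkLaw κ ν) (I : Finset ℝ) (a : ℝ → ℤ) :
    μ {x | ∀ t ∈ I, x t = a t} = ν {x | ∀ t ∈ I, x t = a t} := by
  induction h : I.card generalizing I a μ ν with
  | zero =>
    have := hμ.isProbabilityMeasure
    have := hν.isProbabilityMeasure
    simp [Finset.card_eq_zero.1 h]
  | succ n ih =>
    have := hμ.isProbabilityMeasure
    have := hν.isProbabilityMeasure
    have hI : I.Nonempty := Finset.card_pos.1 (by omega)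
    set m := I.min' hI with hm
    have hmI : m ∈ I := I.min'_mem hI
    have hcard : (I.erase m).card = n := by rw [Finset.card_erase_of_mem hmI]; omega
    rcases le_or_gt m 0 with hm0 | hm0
    · by_cases ham : a m = 0
      · have : ∀ x : Traj, (∀ t ∈ I, x t = a t) ↔ ∀ t ∈ I.erase m, x t = a t := by
          intro x
          refine ⟨fun hx t ht => hx t (Finset.mem_of_mem_erase ht), fun hx t ht => ?_⟩
          rcases eq_or_ne t m with rfl | htm
          · rw [x.apply_nonpos hm0, ham]
          · exact hx t (Finset.mem_erase.2 ⟨htm, ht⟩)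
        simp_rw [this]
        exact ih hμ hν _ a hcard
      · have : {x : Traj | ∀ t ∈ I, x t = a t} = ∅ := by
          ext x
          simp only [Set.mem_ofPred_eq, Set.mem_empty_iff_false, iff_false]
          intro hx
          exact ham (by rw [← hx m hmI, x.apply_nonpos hm0])
        rw [this, measure_empty, measure_empty]
    · set I' : Finset ℝ := (I.erase m).image (fun t => t - m) with hI'
      have hcard' : I'.card = n := by
        rw [hI', Finset.card_image_of_injective _ (sub_left_injective), hcard]
      have key : ∀ (π : Measure Traj), IsWalkLaw κ π → π {x | ∀ t ∈ I, x t = a t} =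
          ENNReal.ofReal (κ m (a m)) *
            (π.map (shift m)) {x | ∀ t ∈ I', x t = a (m + t) - a m} := by
        intro π hπ
        have := hπ.isProbabilityMeasure
        have hmeas : MeasurableSet {x : Traj | ∀ t ∈ I', x t = a (m + t) - a m} := by
          have : {x : Traj | ∀ t ∈ I', x t = a (m + t) - a m} =
              ⋂ t ∈ I', {x : Traj | x t = a (m + t) - a m} := by ext; simp
          rw [this]
          exact Finset.measurableSet_biInter _
            fun t _ => measurable_eval t (measurableSet_singleton _)
        have hset : {x : Traj | ∀ t ∈ I, x t = a t} = stopAt m ⁻¹' {x | x m = a m} ∩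
            shift m ⁻¹' {x | ∀ t ∈ I', x t = a (m + t) - a m} := by
          ext x
          simp only [Set.mem_ofPred_eq, Set.mem_inter_iff, Set.mem_preimage,
            stopAt_apply_of_le x le_rfl, hI', Finset.mem_image, forall_exists_index, and_imp,
            forall_apply_eq_imp_iff₂]
          constructor
          · intro hx
            refine ⟨hx m hmI, fun t ht => ?_⟩
            have htI := Finset.mem_of_mem_erase ht
            rw [shift_apply _ _ (sub_nonneg.2 (I.min'_le t htI)), add_sub_cancel, hx t htI,
              hx m hmI]
          · rintro ⟨h1, h2⟩ t ht
            rcases eq_or_ne t m with rfl | htm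
            · exact h1
            · have := h2 t (Finset.mem_erase.2 ⟨htm, ht⟩)
              rw [shift_apply _ _ (sub_nonneg.2 (I.min'_le t ht)), add_sub_cancel, h1] at this
              linarith
        have hmeas' : MeasurableSet {x : Traj | x m = a m} :=
          measurable_eval m (measurableSet_singleton _)
        rw [hset, (hπ.indepFun m hm0.le).measure_inter_preimage_eq_mul _ _ hmeas' hmeas,
          Measure.map_apply (measurable_shift m) hmeas]
        congr 1
        rw [← hπ.increment 0 m le_rfl hm0.le, ofReal_measureReal]
        congr 1
        ext x
        simp [stopAt_apply_of_le, x.apply_nonpos le_rfl]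
      rw [key μ hμ, key ν hν]
      congr 1
      exact ih (hμ.map_shift hm0.le) (hν.map_shift hm0.le) I' (fun t => a (m + t) - a m) hcard'

/-- The law of a walk is determined by the law of its increments. -/
theorem unique (hμ : IsWalkLaw κ μ) (hν : IsWalkLaw κ ν) : μ = ν := by
  have := hμ.isProbabilityMeasure
  have := hν.isProbabilityMeasure
  have h : μ.map toFun = ν.map toFun := by
    have : ∀ I : Finset ℝ, IsFiniteMeasure
        ((ν.map toFun).map (I.restrict (π := fun _ => ℤ))) :=
      fun I => inferInstance
    refine IsProjectiveLimit.unique (P := fun I =>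
      (ν.map toFun).map (I.restrict (π := fun _ => ℤ)))
      (fun I => ?_) (fun I => rfl)
    have hr : Measurable (I.restrict (π := fun _ : ℝ => ℤ)) := Finset.measurable_restrict I
    beta_reduce
    rw [Measure.map_map hr measurable_coe, Measure.map_map hr measurable_coe]
    refine Measure.ext_of_singleton fun b => ?_
    rw [Measure.map_apply (hr.comp measurable_coe) (measurableSet_singleton b),
      Measure.map_apply (hr.comp measurable_coe) (measurableSet_singleton b)]
    have : ((I.restrict (π := fun _ : ℝ => ℤ)) ∘ toFun) ⁻¹' {b} =
        {x | ∀ t ∈ I, x t = (fun t => if ht : t ∈ I then b ⟨t, ht⟩ else 0) t} := by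
      ext x
      simp only [Set.mem_preimage, Set.mem_singleton_iff, funext_iff, Set.mem_ofPred_eq,
        Function.comp, Finset.restrict, Subtype.forall]
      exact forall₂_congr fun t ht => by simp [ht]
    rw [this]
    exact measure_cylinder_eq hμ hν I _
  refine Measure.ext fun s hs => ?_
  obtain ⟨S, hS, rfl⟩ := hs
  have e := congrArg (fun m => m S) h
  simpa only [Measure.map_apply measurable_coe hS] using e

lemma map_shift_eq (h : IsWalkLaw κ μ) {s : ℝ} (hs : 0 ≤ s) : μ.map (shift s) = μ :=
  (h.map_shift hs).unique h

lemma measurePreserving_shift (h : IsWalkLaw κ μ) {s : ℝ} (hs : 0 ≤ s) :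
    MeasurePreserving (shift s) μ μ :=
  ⟨measurable_shift s, h.map_shift_eq hs⟩

lemma measure_eval_eq (h : IsWalkLaw κ μ) {t : ℝ} (ht : 0 ≤ t) (z : ℤ) :
    μ {x | x t = z} = ENNReal.ofReal (κ t z) := by
  have := h.isProbabilityMeasure
  rw [← h.increment 0 t le_rfl ht, ofReal_measureReal]
  congr 1
  ext x
  simp [x.apply_nonpos le_rfl]

/-- The Markov property at time `s`. -/
lemma lintegral_stopAt_shift (h : IsWalkLaw κ μ) {s : ℝ} (hs : 0 ≤ s) {Φ : Traj × Traj → ℝ≥0∞}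
    (hΦ : Measurable Φ) :
    ∫⁻ x, Φ (stopAt s x, shift s x) ∂μ = ∫⁻ x, ∫⁻ z, Φ (stopAt s x, z) ∂μ ∂μ := by
  have := h.isProbabilityMeasure
  have e := (indepFun_iff_map_prod_eq_prod_map_map (measurable_stopAt s).aemeasurable
    (measurable_shift s).aemeasurable).1 (h.indepFun s hs)
  rw [← lintegral_map (f := Φ) (g := fun x => (stopAt s x, shift s x)) hΦ
    ((measurable_stopAt s).prodMk (measurable_shift s)), e, h.map_shift_eq hs,
    lintegral_prod _ hΦ.aemeasurable, lintegral_map _ (measurable_stopAt s)]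
  exact hΦ.lintegral_prod_right'

end IsWalkLaw

/-! ### From independent increments to a law on path space -/

/-- A nonempty finite set is the range of a monotone sequence. -/
lemma exists_monotone_enumeration {α : Type*} [LinearOrder α] (K : Finset α) (hK : K.Nonempty) :
    ∃ t : ℕ → α, Monotone t ∧ (∀ i, t i ∈ K) ∧ ∀ u ∈ K, ∃ i, t i = u := by
  have hc : 0 < K.card := Finset.card_pos.2 hK
  refine ⟨fun i => K.orderEmbOfFin rfl ⟨min i (K.card - 1), by omega⟩, fun i j hij => ?_,
    fun i => Finset.orderEmbOfFin_mem _ _ _, fun u hu => ?_⟩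
  · refine (K.orderEmbOfFin rfl).monotone ?_
    simp only [Fin.mk_le_mk]
    omega
  · obtain ⟨i, hi⟩ : u ∈ Set.range (K.orderEmbOfFin rfl) := by
      rw [Finset.range_orderEmbOfFin]; exact hu
    refine ⟨i, ?_⟩
    rw [← hi]
    refine congrArg _ (Fin.ext ?_)
    simp only
    omega

/-- Along an increasing enumeration of all the times involved, past positions and future
displacements are sums of consecutive increments over disjoint index sets. -/
lemma indepFun_past_future {Ω : Type*} [MeasurableSpace Ω] {P : Measure Ω} {W : ℝ≥0 → Ω → ℤ}
    (hm : ∀ t, Measurable (W t)) (h0 : ∀ ω, W 0 ω = 0) (hW : HasIndepIncrements W P)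
    {ι ι' : Type*} [Finite ι] [Finite ι'] (s : ℝ≥0) (a : ι → ℝ≥0) (ha : ∀ i, a i ≤ s)
    (b : ι' → ℝ≥0) (hb : ∀ j, s ≤ b j) :
    IndepFun (fun ω i => W (a i) ω) (fun ω j => W (b j) ω - W s ω) P := by
  classical
  have := Fintype.ofFinite ι
  have := Fintype.ofFinite ι'
  -- The time 0 turns positions into sums of increments, and `s` separates past from future.
  set K : Finset ℝ≥0 := {0, s} ∪ (Finset.univ.image a ∪ Finset.univ.image b) with hK
  obtain ⟨t, ht, -, htK⟩ := exists_monotone_enumeration K ⟨0, by simp [hK]⟩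
  obtain ⟨m, hms⟩ := htK s (by simp [hK])
  have ht0 : t 0 = 0 := by
    obtain ⟨i, hi⟩ := htK 0 (by simp [hK])
    exact le_antisymm ((ht (Nat.zero_le i)).trans_eq hi) bot_le
  have hka : ∀ i, ∃ k, k ≤ m ∧ t k = a i := by
    intro i
    obtain ⟨k, hk⟩ := htK (a i) (by simp [hK])
    refine ⟨min k m, min_le_right _ _, ?_⟩
    rw [ht.map_min, hk, hms, min_eq_left (ha i)]
  have hkb : ∀ j, ∃ k, m ≤ k ∧ t k = b j := by
    intro j
    obtain ⟨k, hk⟩ := htK (b j) (by simp [hK])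
    refine ⟨max k m, le_max_right _ _, ?_⟩
    rw [ht.map_max, hk, hms, max_eq_left (hb j)]
  choose ka hka1 hka2 using hka
  choose kb hkb1 hkb2 using hkb
  set N := m + ∑ j, kb j with hN
  have hkbN : ∀ j, kb j ≤ N := fun j =>
    (Finset.single_le_sum (f := kb) (fun _ _ => Nat.zero_le _) (Finset.mem_univ j)).trans
      (by omega)
  set D : ℕ → Ω → ℤ := fun i ω => W (t (i + 1)) ω - W (t i) ω with hD
  have hDm : ∀ i, Measurable (D i) := fun i => (hm _).sub (hm _)
  have hind := (hW.nat ht).indepFun_finset (Finset.range m) (Finset.Ico m N)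
    (Finset.disjoint_left.2 fun i hi hi' => by simp at hi hi'; omega) hDm
  have hS : ∀ j k, j ≤ k → ∀ ω, W (t k) ω - W (t j) ω = ∑ i ∈ Finset.Ico j k, D i ω :=
    fun j k hjk ω => (Finset.sum_Ico_sub (fun i => W (t i) ω) hjk).symm
  set φ : ((i : Finset.range m) → ℤ) → ι → ℤ :=
    fun d i => ∑ k : Finset.range m, if (k : ℕ) < ka i then d k else 0 with hφ
  set ψ : ((i : Finset.Ico m N) → ℤ) → ι' → ℤ :=
    fun d j => ∑ k : Finset.Ico m N, if (k : ℕ) < kb j then d k else 0 with hψ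
  have hφm : Measurable φ := measurable_of_countable _
  have hψm : Measurable ψ := measurable_of_countable _
  refine (hind.comp hφm hψm).congr (Eventually.of_forall fun ω => funext fun i => ?_)
    (Eventually.of_forall fun ω => funext fun j => ?_)
  · have e := hS 0 (ka i) (Nat.zero_le _) ω
    rw [ht0, h0, sub_zero, hka2] at e
    simp only [Function.comp, hφ]
    rw [e, Finset.sum_coe_sort (Finset.range m) (fun k => if k < ka i then D k ω else 0),
      ← Finset.sum_filter]
    refine Finset.sum_congr ?_ fun _ _ => rfl
    ext k
    have := hka1 i
    simp only [Finset.mem_filter, Finset.mem_range, Finset.mem_Ico]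
    omega
  · have e := hS m (kb j) (hkb1 j) ω
    rw [hms, hkb2] at e
    simp only [Function.comp, hψ]
    rw [e, Finset.sum_coe_sort (Finset.Ico m N) (fun k => if k < kb j then D k ω else 0),
      ← Finset.sum_filter]
    refine Finset.sum_congr ?_ fun _ _ => rfl
    ext k
    have := hkbN j
    simp only [Finset.mem_filter, Finset.mem_Ico]
    omega

namespace IsRandomWalk

variable {Ω : Type*} [MeasurableSpace Ω] {J : ℤ → ℝ} {W : ℝ≥0 → Ω → ℤ} {P : Measure Ω}

/-- The trajectories of a slowed walk. -/
def traj (hW : IsRandomWalk J W P) {r : ℝ} (hr : 0 ≤ r) (ω : Ω) : Traj where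
  toFun t := slowed r W t ω
  apply_nonpos' t ht := by
    have : r * t ≤ 0 := mul_nonpos_of_nonneg_of_nonpos hr ht
    rw [slowed, Real.toNNReal_of_nonpos this, hW.zero]
  rightCont t := by
    refine (hW.right_continuous ω _).comp (t := Set.Ici (r * t).toNNReal)
      (f := fun t : ℝ => (r * t).toNNReal) (by fun_prop) ?_
    intro u hu
    have : t ≤ u := hu
    simp only [Set.mem_Ici]
    gcongr

lemma measurable_traj (hW : IsRandomWalk J W P) {r : ℝ} (hr : 0 ≤ r) :
    Measurable (hW.traj hr) :=
  measurable_of_eval fun _ => hW.measurable _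

lemma isWalkLaw [IsProbabilityMeasure P] (hW : IsRandomWalk J W P) {r : ℝ} (hr : 0 ≤ r) :
    IsWalkLaw (fun t => transitionProb J (r * t)) (P.map (hW.traj hr)) := by
  have hm := hW.measurable_traj hr
  refine ⟨Measure.isProbabilityMeasure_map hm.aemeasurable, fun s hs => ?_,
    fun s t hs ht z => ?_⟩
  · refine indepFun_map hm (measurable_stopAt s) (measurable_shift s) ?_
    have key : IndepFun (fun ω (t : ℝ) => slowed r W (min t s) ω)
        (fun ω (t : ℝ) => slowed r W (s + max t 0) ω - slowed r W s ω) P := by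
      refine IndepFun.process_indepFun_process (fun t => hW.measurable _)
        (fun t => (hW.measurable _).sub (hW.measurable _)) fun I I' => ?_
      refine indepFun_past_future hW.measurable hW.zero hW.indep_increments (r * s).toNNReal
        (fun i : I => (r * min (i : ℝ) s).toNNReal) (fun i => ?_)
        (fun i : I' => (r * (s + max (i : ℝ) 0)).toNNReal) (fun i => ?_)
      · gcongr; exact min_le_right _ _
      · gcongr
        have := le_max_right (i : ℝ) 0
        linarith
    -- The σ-algebra of `Traj` is pulled back from the coordinates, so independence of the two
    -- coordinate processes is already independence of the two trajectories.
    rw [IndepFun_iff_Indep] at key ⊢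
    convert key using 1
    · exact MeasurableSpace.comap_comp
    · exact MeasurableSpace.comap_comp
  · have hms : MeasurableSet {x : Traj | x (s + t) - x s = z} :=
      ((measurable_eval (s + t)).sub (measurable_eval s)) (measurableSet_singleton z)
    rw [map_measureReal_apply hm hms]
    have h := hW.law_increments (r * s).toNNReal (r * t).toNNReal z
    rw [← Real.toNNReal_add (by positivity) (by positivity), ← mul_add,
      Real.coe_toNNReal _ (by positivity)] at h
    exact h

end IsRandomWalk

/-! ### Exponential identities, meeting energies and Boltzmann weights -/

/-- The exponential of the integral of a right-continuous function, as an integral. -/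
lemma exp_integral_eq {h : ℝ → ℝ} (hm : Measurable h) (hb : ∀ u, |h u| ≤ 1)
    (hr : ∀ t, ContinuousWithinAt h (Set.Ici t) t) (β : ℝ) {T : ℝ} (hT : 0 ≤ T) :
    Real.exp (β * ∫ u in (0 : ℝ)..T, h u) =
      1 + ∫ u in (0 : ℝ)..T, β * h u * Real.exp (β * ∫ v in (0 : ℝ)..u, h v) := by
  have hint : ∀ a b : ℝ, IntervalIntegrable h volume a b := fun a b =>
    (intervalIntegrable_const (c := (1 : ℝ))).mono_fun hm.aestronglyMeasurable
      (Eventually.of_forall fun u => by simpa using hb u)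
  have hcont : Continuous fun u => ∫ v in (0 : ℝ)..u, h v :=
    intervalIntegral.continuous_primitive hint 0
  have hc : Continuous fun u => Real.exp (β * ∫ v in (0 : ℝ)..u, h v) := by fun_prop
  -- The integrand `h` is only right-continuous, so its primitive is differentiated from the right.
  have key := intervalIntegral.integral_eq_sub_of_hasDeriv_right_of_le hT
    (f := fun u => Real.exp (β * ∫ v in (0 : ℝ)..u, h v))
    (f' := fun u => β * h u * Real.exp (β * ∫ v in (0 : ℝ)..u, h v)) hc.continuousOn
    (fun u _ => by
      have h1 : HasDerivWithinAt (fun u => ∫ v in (0 : ℝ)..u, h v) (h u) (Set.Ioi u) u :=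
        (intervalIntegral.integral_hasDerivWithinAt_right (hint 0 u) (s := Set.Ici u)
          (t := Set.Ioi u) hm.stronglyMeasurable.stronglyMeasurableAtFilter
          ((hr u).mono Set.Ioi_subset_Ici_self)).mono Set.Ioi_subset_Ici_self
      have h2 := (h1.const_mul β).exp
      exact h2.congr_deriv (by ring))
    (((hint 0 T).const_mul β).mul_continuousOn hc.continuousOn)
  rw [key]
  simp

/-- Variant of `exp_integral_eq` where the integral under the exponential runs to the end. -/
lemma exp_integral_eq' {h : ℝ → ℝ} (hm : Measurable h) (hb : ∀ u, |h u| ≤ 1)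
    (hr : ∀ t, ContinuousWithinAt h (Set.Ici t) t) (β : ℝ) {T : ℝ} (hT : 0 ≤ T) :
    Real.exp (β * ∫ u in (0 : ℝ)..T, h u) =
      1 + ∫ u in (0 : ℝ)..T, β * h u *
        Real.exp (β * ((∫ v in (0 : ℝ)..T, h v) - ∫ v in (0 : ℝ)..u, h v)) := by
  -- The identity at `-β`, multiplied by `exp (β * I)`, is the claim.
  have e := exp_integral_eq hm hb hr (-β) hT
  set I := ∫ u in (0 : ℝ)..T, h u with hI
  have e1 : ∀ u, β * h u * Real.exp (β * (I - ∫ v in (0 : ℝ)..u, h v)) =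
      -Real.exp (β * I) * (-β * h u * Real.exp (-β * ∫ v in (0 : ℝ)..u, h v)) := by
    intro u
    rw [mul_sub, sub_eq_add_neg, Real.exp_add, neg_mul β (∫ v in (0 : ℝ)..u, h v)]
    ring
  simp_rw [e1]
  rw [intervalIntegral.integral_const_mul]
  have e2 : Real.exp (β * I) * Real.exp (-β * I) = 1 := by
    rw [← Real.exp_add]; simp
  rw [e] at e2
  linarith

/-- The indicator that the trajectory `a + x` meets `y` at time `u`. -/
def meet (a : ℤ) (x y : Traj) (u : ℝ) : ℝ := if a + x u = y u then 1 else 0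

/-- The time that `a + x` and `y` spend together up to time `T`. -/
def energy (a : ℤ) (x y : Traj) (T : ℝ) : ℝ := ∫ u in (0 : ℝ)..T, meet a x y u

lemma meet_nonneg (a : ℤ) (x y : Traj) (u : ℝ) : 0 ≤ meet a x y u := by
  unfold meet; split_ifs <;> norm_num

lemma meet_le_one (a : ℤ) (x y : Traj) (u : ℝ) : meet a x y u ≤ 1 := by
  unfold meet; split_ifs <;> norm_num

lemma abs_meet_le_one (a : ℤ) (x y : Traj) (u : ℝ) : |meet a x y u| ≤ 1 := by
  rw [abs_of_nonneg (meet_nonneg a x y u)]; exact meet_le_one a x y u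

lemma measurable_meet_prod (a : ℤ) :
    Measurable fun p : (Traj × Traj) × ℝ => meet a p.1.1 p.1.2 p.2 := by
  have h1 : Measurable fun p : (Traj × Traj) × ℝ => p.1.1 p.2 :=
    measurable_uncurry.comp (measurable_snd.prodMk (measurable_fst.comp measurable_fst))
  have h2 : Measurable fun p : (Traj × Traj) × ℝ => p.1.2 p.2 :=
    measurable_uncurry.comp (measurable_snd.prodMk (measurable_snd.comp measurable_fst))
  exact Measurable.ite (measurableSet_eq_fun (h1.const_add a) h2) measurable_const
    measurable_const

lemma measurable_meet (a : ℤ) (x y : Traj) : Measurable (meet a x y) :=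
  (measurable_meet_prod a).comp (measurable_prodMk_left (x := (x, y)))

lemma rightCont_meet (a : ℤ) (x y : Traj) (t : ℝ) :
    ContinuousWithinAt (meet a x y) (Set.Ici t) t := by
  have h : Continuous fun p : ℤ × ℤ => if a + p.1 = p.2 then (1 : ℝ) else 0 :=
    continuous_of_discreteTopology
  exact h.continuousAt.comp_continuousWithinAt ((x.rightCont t).prodMk (y.rightCont t))

lemma intervalIntegrable_meet (a : ℤ) (x y : Traj) (s t : ℝ) :
    IntervalIntegrable (meet a x y) volume s t :=
  (intervalIntegrable_const (c := (1 : ℝ))).mono_fun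
    (measurable_meet a x y).aestronglyMeasurable
    (Eventually.of_forall fun u => by simpa using abs_meet_le_one a x y u)

lemma energy_nonneg (a : ℤ) (x y : Traj) {T : ℝ} (hT : 0 ≤ T) : 0 ≤ energy a x y T :=
  intervalIntegral.integral_nonneg hT fun u _ => meet_nonneg a x y u

lemma energy_le (a : ℤ) (x y : Traj) {T : ℝ} (hT : 0 ≤ T) : energy a x y T ≤ T := by
  have := intervalIntegral.integral_mono_on hT (intervalIntegrable_meet a x y 0 T)
    (intervalIntegrable_const (c := (1 : ℝ))) fun u _ => meet_le_one a x y u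
  simpa [energy] using this

lemma meet_add (a : ℤ) (x y : Traj) (s : ℝ) {u : ℝ} (hu : 0 ≤ u) :
    meet a x y (s + u) = meet (a + x s - y s) (shift s x) (shift s y) u := by
  unfold meet
  rw [shift_apply _ _ hu, shift_apply _ _ hu]
  refine if_congr ⟨fun h => ?_, fun h => ?_⟩ rfl rfl <;> linarith

lemma energy_add (a : ℤ) (x y : Traj) (s : ℝ) {t : ℝ} (ht : 0 ≤ t) :
    energy a x y (s + t) =
      energy a x y s + energy (a + x s - y s) (shift s x) (shift s y) t := by
  unfold energy
  rw [← intervalIntegral.integral_add_adjacent_intervals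
    (intervalIntegrable_meet a x y 0 s) (intervalIntegrable_meet a x y s (s + t))]
  congr 1
  have : ∫ u in (0 : ℝ)..t, meet (a + x s - y s) (shift s x) (shift s y) u =
      ∫ u in (0 : ℝ)..t, meet a x y (s + u) := by
    refine intervalIntegral.integral_congr fun u hu => ?_
    rw [Set.uIcc_of_le ht] at hu
    exact (meet_add a x y s hu.1).symm
  rw [this, intervalIntegral.integral_comp_add_left (fun u => meet a x y u)]
  simp

lemma energy_congr (a : ℤ) {x x' y y' : Traj} {T : ℝ} (hT : 0 ≤ T) (hx : ∀ u ≤ T, x u = x' u)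
    (hy : ∀ u ≤ T, y u = y' u) : energy a x y T = energy a x' y' T := by
  refine intervalIntegral.integral_congr fun u hu => ?_
  rw [Set.uIcc_of_le hT] at hu
  simp only [meet, hx u hu.2, hy u hu.2]

lemma measurable_energy_prod (a : ℤ) (T : ℝ) :
    Measurable fun p : Traj × Traj => energy a p.1 p.2 T := by
  have h : ∀ s : Set ℝ, Measurable fun p : Traj × Traj => ∫ u in s, meet a p.1 p.2 u :=
    fun s => ((measurable_meet_prod a).stronglyMeasurable.integral_prod_right'
      (ν := volume.restrict s)).measurable
  exact (h _).sub (h _)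

lemma measurable_energy (a : ℤ) (y : Traj) (T : ℝ) : Measurable fun x => energy a x y T :=
  (measurable_energy_prod a T).comp (measurable_prodMk_right (y := y))

lemma measurable_energy_time (a : ℤ) (y : Traj) :
    Measurable fun p : Traj × ℝ => energy a p.1 y p.2 := by
  have h : Measurable (Function.uncurry fun (u : ℝ) (x : Traj) => energy a x y u) :=
    measurable_uncurry_of_continuous_of_measurable
      (fun x => intervalIntegral.continuous_primitive (intervalIntegrable_meet a x y) 0)
      (fun u => measurable_energy a y u)
  exact h.comp measurable_swap

/-- The Boltzmann weight. -/
def weight (β : ℝ) (a : ℤ) (x y : Traj) (T : ℝ) : ℝ≥0∞ :=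
  ENNReal.ofReal (Real.exp (β * energy a x y T))

lemma measurable_weight_prod (β : ℝ) (a : ℤ) (T : ℝ) :
    Measurable fun p : Traj × Traj => weight β a p.1 p.2 T :=
  ENNReal.measurable_ofReal.comp
    (Real.measurable_exp.comp ((measurable_energy_prod a T).const_mul β))

lemma measurable_weight (β : ℝ) (a : ℤ) (y : Traj) (T : ℝ) :
    Measurable fun x => weight β a x y T :=
  ENNReal.measurable_ofReal.comp (Real.measurable_exp.comp ((measurable_energy a y T).const_mul β))

lemma one_le_weight {β : ℝ} (hβ : 0 ≤ β) (a : ℤ) (x y : Traj) {T : ℝ} (hT : 0 ≤ T) :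
    1 ≤ weight β a x y T := by
  rw [weight, ← ENNReal.ofReal_one]
  exact ENNReal.ofReal_le_ofReal (Real.one_le_exp (mul_nonneg hβ (energy_nonneg a x y hT)))

lemma weight_le {β : ℝ} (hβ : 0 ≤ β) (a : ℤ) (x y : Traj) {T : ℝ} (hT : 0 ≤ T) :
    weight β a x y T ≤ ENNReal.ofReal (Real.exp (β * T)) := by
  unfold weight
  gcongr
  exact energy_le a x y hT

lemma weight_add (β : ℝ) (a : ℤ) (x y : Traj) (s : ℝ) {t : ℝ} (ht : 0 ≤ t) :
    weight β a x y (s + t) =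
      weight β a x y s * weight β (a + x s - y s) (shift s x) (shift s y) t := by
  rw [weight, energy_add a x y s ht, mul_add, Real.exp_add,
    ENNReal.ofReal_mul (Real.exp_nonneg _), weight, weight]

lemma weight_congr (β : ℝ) (a : ℤ) {x x' y y' : Traj} {T : ℝ} (hT : 0 ≤ T)
    (hx : ∀ u ≤ T, x u = x' u) (hy : ∀ u ≤ T, y u = y' u) :
    weight β a x y T = weight β a x' y' T := by
  rw [weight, weight, energy_congr a hT hx hy]

/-! ### Partition functions: multiplicativity and comparison -/

section Partition

variable (μ : Measure Traj) (β : ℝ)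

/-- The free partition function of a walk started at `a`. -/
def free (a : ℤ) (y : Traj) (T : ℝ) : ℝ≥0∞ := ∫⁻ x, weight β a x y T ∂μ

/-- The largest free partition function over all starting points. -/
def freeSup (y : Traj) (T : ℝ) : ℝ≥0∞ := ⨆ a, free μ β a y T

/-- The weight restricted to the event that the endpoints agree. -/
def pinnedWeight (x y : Traj) (T : ℝ) : ℝ≥0∞ :=
  weight β 0 x y T * if x T = y T then 1 else 0

/-- The partition function pinned at its endpoint. -/
def pinned (y : Traj) (T : ℝ) : ℝ≥0∞ := ∫⁻ x, pinnedWeight β x y T ∂μ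

lemma measurable_pinnedWeight_prod (T : ℝ) :
    Measurable fun p : Traj × Traj => pinnedWeight β p.1 p.2 T :=
  (measurable_weight_prod β 0 T).mul (Measurable.ite
    (measurableSet_eq_fun ((measurable_eval T).comp measurable_fst)
      ((measurable_eval T).comp measurable_snd)) measurable_const measurable_const)

lemma measurable_pinnedWeight (y : Traj) (T : ℝ) : Measurable fun x => pinnedWeight β x y T :=
  (measurable_weight β 0 y T).mul (Measurable.ite
    (measurableSet_eq_fun (measurable_eval T) measurable_const) measurable_const measurable_const)

lemma measurable_free [SFinite μ] (a : ℤ) (T : ℝ) : Measurable fun y => free μ β a y T :=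
  (measurable_weight_prod β a T).lintegral_prod_left'

lemma measurable_freeSup [SFinite μ] (T : ℝ) : Measurable fun y => freeSup μ β y T :=
  Measurable.iSup fun a => measurable_free μ β a T

lemma measurable_pinned [SFinite μ] (T : ℝ) : Measurable fun y => pinned μ β y T :=
  (measurable_pinnedWeight_prod β T).lintegral_prod_left'

lemma freeSup_stopAt (y : Traj) {T : ℝ} (hT : 0 ≤ T) :
    freeSup μ β (stopAt T y) T = freeSup μ β y T := by
  refine iSup_congr fun a => lintegral_congr fun x => ?_
  exact weight_congr β a hT (fun _ _ => rfl) fun u hu => stopAt_apply_of_le y hu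

lemma pinned_stopAt (y : Traj) {T : ℝ} (hT : 0 ≤ T) :
    pinned μ β (stopAt T y) T = pinned μ β y T := by
  refine lintegral_congr fun x => ?_
  rw [pinnedWeight, pinnedWeight, stopAt_apply_of_le y le_rfl,
    weight_congr β 0 hT (fun _ _ => rfl) fun u hu => stopAt_apply_of_le y hu]

variable {μ β} {κ : ℝ → ℤ → ℝ}

lemma one_le_free [IsProbabilityMeasure μ] (hβ : 0 ≤ β) (a : ℤ) (y : Traj) {T : ℝ}
    (hT : 0 ≤ T) : 1 ≤ free μ β a y T := by
  calc (1 : ℝ≥0∞) = ∫⁻ _, 1 ∂μ := by simp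
    _ ≤ _ := lintegral_mono fun x => one_le_weight hβ a x y hT

lemma free_le [IsProbabilityMeasure μ] (hβ : 0 ≤ β) (a : ℤ) (y : Traj) {T : ℝ}
    (hT : 0 ≤ T) : free μ β a y T ≤ ENNReal.ofReal (Real.exp (β * T)) := by
  calc free μ β a y T ≤ ∫⁻ _, ENNReal.ofReal (Real.exp (β * T)) ∂μ :=
        lintegral_mono fun x => weight_le hβ a x y hT
    _ = _ := by simp

lemma free_le_freeSup (a : ℤ) (y : Traj) (T : ℝ) : free μ β a y T ≤ freeSup μ β y T :=
  le_iSup (fun a => free μ β a y T) a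

lemma freeSup_le [IsProbabilityMeasure μ] (hβ : 0 ≤ β) (y : Traj) {T : ℝ}
    (hT : 0 ≤ T) : freeSup μ β y T ≤ ENNReal.ofReal (Real.exp (β * T)) :=
  iSup_le fun a => free_le hβ a y hT

lemma pinned_le_free (y : Traj) (T : ℝ) : pinned μ β y T ≤ free μ β 0 y T := by
  refine lintegral_mono fun x => ?_
  unfold pinnedWeight
  split_ifs <;> simp

/-- Reaching the right endpoint is enough for a lower bound on the pinned partition function. -/
lemma ofReal_le_pinned (hμ : IsWalkLaw κ μ) (hβ : 0 ≤ β) (y : Traj) {T : ℝ} (hT : 0 ≤ T) :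
    ENNReal.ofReal (κ T (y T)) ≤ pinned μ β y T := by
  have := hμ.isProbabilityMeasure
  have hm : MeasurableSet {x : Traj | x T = y T} := measurable_eval T (measurableSet_singleton _)
  calc ENNReal.ofReal (κ T (y T)) = μ {x | x T = y T} :=
        (hμ.measure_eval_eq hT _).symm
    _ = ∫⁻ x, {x : Traj | x T = y T}.indicator 1 x ∂μ := (lintegral_indicator_one hm).symm
    _ ≤ _ := by
        refine lintegral_mono fun x => ?_
        by_cases h : x T = y T
        · simpa [pinnedWeight, h] using one_le_weight hβ 0 x y hT
        · simp [h]

/-- At time `s` the position of the walk relative to `y` is arbitrary, but the supremum over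
starting points covers every case; the Markov property does the rest. -/
lemma freeSup_add_le (hμ : IsWalkLaw κ μ) (y : Traj) {s t : ℝ} (hs : 0 ≤ s) (ht : 0 ≤ t) :
    freeSup μ β y (s + t) ≤ freeSup μ β y s * freeSup μ β (shift s y) t := by
  have := hμ.isProbabilityMeasure
  refine iSup_le fun a => ?_
  set Φ : Traj × Traj → ℝ≥0∞ := fun p =>
    weight β a p.1 y s * weight β (a + p.1 s - y s) p.2 (shift s y) t with hΦ
  have hΦm : Measurable Φ := by
    refine ((measurable_weight β a y s).comp measurable_fst).mul ?_
    -- The random starting point is an integer, so measurability is checked for each value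
    -- separately.
    have h : Measurable fun q : ℤ × Traj => weight β (a + q.1 - y s) q.2 (shift s y) t :=
      measurable_from_prod_countable_right fun k =>
        measurable_weight β (a + k - y s) (shift s y) t
    exact Measurable.comp (f := fun p : Traj × Traj => (p.1 s, p.2)) h
      (((measurable_eval s).comp measurable_fst).prodMk measurable_snd)
  calc free μ β a y (s + t) = ∫⁻ x, Φ (stopAt s x, shift s x) ∂μ := by
        refine lintegral_congr fun x => ?_
        rw [weight_add β a x y s ht, hΦ]
        simp only [stopAt_apply_of_le x le_rfl]
        rw [weight_congr β a hs (fun u hu => (stopAt_apply_of_le x hu)) fun _ _ => rfl]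
    _ = ∫⁻ x, ∫⁻ z, Φ (stopAt s x, z) ∂μ ∂μ := hμ.lintegral_stopAt_shift hs hΦm
    _ ≤ ∫⁻ x, weight β a x y s * freeSup μ β (shift s y) t ∂μ := by
        refine lintegral_mono fun x => ?_
        simp only [hΦ]
        rw [lintegral_const_mul _ (measurable_weight β _ _ _),
          weight_congr β a hs (fun u hu => (stopAt_apply_of_le x hu)) fun _ _ => rfl]
        gcongr
        exact free_le_freeSup _ _ _
    _ = free μ β a y s * freeSup μ β (shift s y) t :=
        lintegral_mul_const _ (measurable_weight β a y s)
    _ ≤ _ := by gcongr; exact free_le_freeSup _ _ _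

/-- Keep only the paths that also meet `y` at time `s`. From there both trajectories restart from a
common site, so the second factor has offset 0. -/
lemma mul_pinned_le (hμ : IsWalkLaw κ μ) (y : Traj) {s t : ℝ} (hs : 0 ≤ s) (ht : 0 ≤ t) :
    pinned μ β y s * pinned μ β (shift s y) t ≤ pinned μ β y (s + t) := by
  have := hμ.isProbabilityMeasure
  set Φ : Traj × Traj → ℝ≥0∞ := fun p =>
    pinnedWeight β p.1 y s * pinnedWeight β p.2 (shift s y) t with hΦ
  have hΦm : Measurable Φ := ((measurable_pinnedWeight β y s).comp measurable_fst).mul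
    ((measurable_pinnedWeight β (shift s y) t).comp measurable_snd)
  have hstopped : ∀ x, pinnedWeight β (stopAt s x) y s = pinnedWeight β x y s := fun x => by
    rw [pinnedWeight, pinnedWeight, stopAt_apply_of_le x le_rfl,
      weight_congr β 0 hs (fun u hu => stopAt_apply_of_le x hu) fun _ _ => rfl]
  calc pinned μ β y s * pinned μ β (shift s y) t
      = ∫⁻ x, ∫⁻ z, Φ (stopAt s x, z) ∂μ ∂μ := by
        simp only [hΦ, hstopped]
        simp_rw [lintegral_const_mul _ (measurable_pinnedWeight β (shift s y) t)]
        rw [lintegral_mul_const _ (measurable_pinnedWeight β y s)]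
        rfl
    _ = ∫⁻ x, Φ (stopAt s x, shift s x) ∂μ := (hμ.lintegral_stopAt_shift hs hΦm).symm
    _ ≤ _ := by
        refine lintegral_mono fun x => ?_
        simp only [hΦ, hstopped]
        unfold pinnedWeight
        rw [weight_add β 0 x y s ht]
        by_cases h1 : x s = y s
        · rw [shift_apply s x ht, shift_apply s y ht]
          simp only [h1, zero_add, sub_self, sub_left_inj, if_true, mul_one]
          rw [mul_assoc]
        · simp [h1]

/-- Decomposition of the energy at the last meeting time. -/
lemma weight_eq_last (hβ : 0 ≤ β) (a : ℤ) (x y : Traj) {T : ℝ} (hT : 0 ≤ T) :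
    weight β a x y T = 1 + ∫⁻ u in Set.Ioc 0 T,
      ENNReal.ofReal (β * meet a x y u * Real.exp (β * energy a x y u)) := by
  have e := exp_integral_eq (measurable_meet a x y) (abs_meet_le_one a x y)
    (rightCont_meet a x y) β hT
  have hnn : ∀ u, 0 ≤ β * meet a x y u * Real.exp (β * energy a x y u) := fun u =>
    mul_nonneg (mul_nonneg hβ (meet_nonneg a x y u)) (Real.exp_nonneg _)
  have hc : Continuous fun u => Real.exp (β * energy a x y u) := by
    have := intervalIntegral.continuous_primitive (intervalIntegrable_meet a x y) 0
    unfold energy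
    fun_prop
  have hint : IntervalIntegrable (fun u => β * meet a x y u * Real.exp (β * energy a x y u))
      volume 0 T :=
    ((intervalIntegrable_meet a x y 0 T).const_mul β).mul_continuousOn hc.continuousOn
  unfold weight
  rw [← ofReal_integral_eq_lintegral_ofReal
    ((intervalIntegrable_iff_integrableOn_Ioc_of_le hT).1 hint) (Eventually.of_forall hnn),
    ← ENNReal.ofReal_one, ← ENNReal.ofReal_add zero_le_one (integral_nonneg hnn),
    ← intervalIntegral.integral_of_le hT]
  exact congrArg _ e

/-- Decomposition of the energy at the first meeting time. -/
lemma weight_eq_first (hβ : 0 ≤ β) (a : ℤ) (x y : Traj) {T : ℝ} (hT : 0 ≤ T) :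
    weight β a x y T = 1 + ∫⁻ u in Set.Ioc 0 T,
      ENNReal.ofReal (β * meet a x y u *
        Real.exp (β * (energy a x y T - energy a x y u))) := by
  have e := exp_integral_eq' (measurable_meet a x y) (abs_meet_le_one a x y)
    (rightCont_meet a x y) β hT
  have hnn : ∀ u, 0 ≤ β * meet a x y u *
      Real.exp (β * (energy a x y T - energy a x y u)) := fun u =>
    mul_nonneg (mul_nonneg hβ (meet_nonneg a x y u)) (Real.exp_nonneg _)
  have hc : Continuous fun u => Real.exp (β * (energy a x y T - energy a x y u)) := by
    have := intervalIntegral.continuous_primitive (intervalIntegrable_meet a x y) 0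
    unfold energy
    fun_prop
  have hint : IntervalIntegrable (fun u => β * meet a x y u *
      Real.exp (β * (energy a x y T - energy a x y u))) volume 0 T :=
    ((intervalIntegrable_meet a x y 0 T).const_mul β).mul_continuousOn hc.continuousOn
  unfold weight
  rw [← ofReal_integral_eq_lintegral_ofReal
    ((intervalIntegrable_iff_integrableOn_Ioc_of_le hT).1 hint) (Eventually.of_forall hnn),
    ← ENNReal.ofReal_one, ← ENNReal.ofReal_add zero_le_one (integral_nonneg hnn),
    ← intervalIntegral.integral_of_le hT]
  exact congrArg _ e

/-- The Tonelli step shared by the two decompositions over meeting times. -/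
lemma lintegral_one_add_le [IsProbabilityMeasure μ] {g : Traj → ℝ → ℝ≥0∞}
    (hg : Measurable (Function.uncurry g)) {T : ℝ} (hT : 0 ≤ T) (hβ : 0 ≤ β) {c : ℝ≥0∞}
    (hc1 : 1 ≤ c) (hc : ∀ u, 0 ≤ u → u ≤ T → ∫⁻ x, g x u ∂μ ≤ ENNReal.ofReal β * c) :
    ∫⁻ x, (1 + ∫⁻ u in Set.Ioc 0 T, g x u) ∂μ ≤ ENNReal.ofReal (1 + β * T) * c := by
  have hgm : Measurable fun x => ∫⁻ u in Set.Ioc 0 T, g x u := hg.lintegral_prod_right'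
  rw [lintegral_add_left measurable_const, lintegral_lintegral_swap hg.aemeasurable,
    ENNReal.ofReal_add zero_le_one (by positivity), add_mul]
  refine add_le_add (by simpa using hc1) ?_
  calc ∫⁻ u in Set.Ioc 0 T, ∫⁻ x, g x u ∂μ
      ≤ ∫⁻ u in Set.Ioc 0 T, ENNReal.ofReal β * c :=
        setLIntegral_mono measurable_const fun u hu => hc u hu.1.le hu.2
    _ = _ := by
        rw [setLIntegral_const, Real.volume_Ioc, sub_zero, ENNReal.ofReal_mul hβ]
        ring

/-- In `weight_eq_last` the integrand at `u` is `β` times the pinned weight up to `u`: what happens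
after the chosen meeting has been integrated out. -/
lemma free_zero_le [IsProbabilityMeasure μ] (hβ : 0 ≤ β) (y : Traj) {T : ℝ} (hT : 0 ≤ T)
    {c : ℝ≥0∞} (hc1 : 1 ≤ c) (hc : ∀ u, 0 ≤ u → u ≤ T → pinned μ β y u ≤ c) :
    free μ β 0 y T ≤ ENNReal.ofReal (1 + β * T) * c := by
  unfold free
  simp_rw [fun x => weight_eq_last hβ 0 x y hT]
  refine lintegral_one_add_le (g := fun x u => ENNReal.ofReal (β * meet 0 x y u *
    Real.exp (β * energy 0 x y u))) ?_ hT hβ hc1 fun u hu0 huT => ?_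
  · refine ENNReal.measurable_ofReal.comp (Measurable.mul (Measurable.const_mul ?_ β)
      (Real.measurable_exp.comp ((measurable_energy_time 0 y).const_mul β)))
    exact (measurable_meet_prod 0).comp
      ((measurable_fst.prodMk measurable_const).prodMk measurable_snd)
  · calc ∫⁻ x, ENNReal.ofReal (β * meet 0 x y u * Real.exp (β * energy 0 x y u)) ∂μ
        = ∫⁻ x, ENNReal.ofReal β * pinnedWeight β x y u ∂μ := by
          refine lintegral_congr fun x => ?_
          rw [mul_assoc, ENNReal.ofReal_mul hβ]
          congr 1
          by_cases h : x u = y u <;> simp [meet, pinnedWeight, weight, h]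
      _ = ENNReal.ofReal β * pinned μ β y u :=
          lintegral_const_mul _ (measurable_pinnedWeight β y u)
      _ ≤ _ := by gcongr; exact hc u hu0 huT

/-- In `weight_eq_first` only the energy after the chosen meeting `u` remains, and there the offset
is 0; this removes the dependence on the starting point `a`. -/
lemma free_le_of_shift (hμ : IsWalkLaw κ μ) (hβ : 0 ≤ β) (a : ℤ) (y : Traj) {T : ℝ}
    (hT : 0 ≤ T) {c : ℝ≥0∞} (hc1 : 1 ≤ c)
    (hc : ∀ u, 0 ≤ u → u ≤ T → free μ β 0 (shift u y) (T - u) ≤ c) :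
    free μ β a y T ≤ ENNReal.ofReal (1 + β * T) * c := by
  have := hμ.isProbabilityMeasure
  unfold free
  simp_rw [fun x => weight_eq_first hβ a x y hT]
  refine lintegral_one_add_le (g := fun x u => ENNReal.ofReal (β * meet a x y u *
    Real.exp (β * (energy a x y T - energy a x y u)))) ?_ hT hβ hc1 fun u hu0 huT => ?_
  · refine ENNReal.measurable_ofReal.comp (Measurable.mul (Measurable.const_mul ?_ β)
      (Real.measurable_exp.comp ((((measurable_energy a y T).comp measurable_fst).sub
        (measurable_energy_time a y)).const_mul β)))
    exact (measurable_meet_prod a).comp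
      ((measurable_fst.prodMk measurable_const).prodMk measurable_snd)
  · calc ∫⁻ x, ENNReal.ofReal (β * meet a x y u *
          Real.exp (β * (energy a x y T - energy a x y u))) ∂μ
        ≤ ∫⁻ x, ENNReal.ofReal β * weight β 0 (shift u x) (shift u y) (T - u) ∂μ := by
          refine lintegral_mono fun x => ?_
          rw [mul_assoc, ENNReal.ofReal_mul hβ]
          gcongr
          by_cases h : a + x u = y u
          · have e := energy_add a x y u (sub_nonneg.2 huT)
            rw [add_sub_cancel, h, sub_self] at e
            rw [e, add_sub_cancel_left]
            simp [meet, weight, h]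
          · simp [meet, h]
      _ = ENNReal.ofReal β * ∫⁻ x, weight β 0 x (shift u y) (T - u) ∂μ := by
          have hw : Measurable fun x => weight β 0 (shift u x) (shift u y) (T - u) :=
            Measurable.comp (g := fun x => weight β 0 x (shift u y) (T - u))
              (measurable_weight β 0 (shift u y) (T - u)) (measurable_shift u)
          rw [lintegral_const_mul _ hw]
          congr 1
          exact (hμ.measurePreserving_shift hu0).lintegral_comp (measurable_weight β 0 _ _)
      _ ≤ _ := by gcongr; exact hc u hu0 huT

/-- The free partition function is controlled by the pinned ones over all subintervals. -/
lemma freeSup_le_of_pinned (hμ : IsWalkLaw κ μ) (hβ : 0 ≤ β) (y : Traj) {T : ℝ} (hT : 0 ≤ T)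
    {c : ℝ≥0∞} (hc1 : 1 ≤ c)
    (hc : ∀ u v, 0 ≤ u → 0 ≤ v → u + v ≤ T → pinned μ β (shift u y) v ≤ c) :
    freeSup μ β y T ≤ ENNReal.ofReal ((1 + β * T) ^ 2) * c := by
  have := hμ.isProbabilityMeasure
  refine iSup_le fun a => ?_
  rw [sq, ENNReal.ofReal_mul (by positivity), mul_assoc]
  have h1 : 1 ≤ ENNReal.ofReal (1 + β * T) := by
    rw [← ENNReal.ofReal_one]
    exact ENNReal.ofReal_le_ofReal (by nlinarith [mul_nonneg hβ hT])
  refine free_le_of_shift hμ hβ a y hT (one_le_mul h1 hc1) fun u hu0 huT => ?_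
  refine (free_zero_le hβ (shift u y) (sub_nonneg.2 huT) hc1 fun v hv0 hvT =>
    hc u v hu0 hv0 (by linarith)).trans ?_
  gcongr
  linarith

end Partition

/-! ### Moments of the running maximum -/

/-- The weight `|z| ^ α`. -/
def absPow (α : ℝ) (z : ℤ) : ℝ≥0∞ := ENNReal.ofReal (|(z : ℝ)| ^ α)

lemma absPow_zero {α : ℝ} (hα : 0 < α) : absPow α 0 = 0 := by
  simp [absPow, Real.zero_rpow hα.ne']

lemma absPow_add_le {α : ℝ} (hα : 0 < α) (hα1 : α ≤ 1) (x y : ℤ) :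
    absPow α (x + y) ≤ absPow α x + absPow α y := by
  unfold absPow
  rw [← ENNReal.ofReal_add (by positivity) (by positivity)]
  refine ENNReal.ofReal_le_ofReal ?_
  push_cast
  calc |(x : ℝ) + y| ^ α ≤ (|(x : ℝ)| + |(y : ℝ)|) ^ α :=
        Real.rpow_le_rpow (abs_nonneg _) (abs_add_le _ _) hα.le
    _ ≤ _ := Real.rpow_add_le_add_rpow (abs_nonneg _) (abs_nonneg _) hα.le hα1

/-- The increment laws `κ t` have `α`-moments at most `M t`. -/
def MomentBound (κ : ℝ → ℤ → ℝ) (α : ℝ) (M : ℝ≥0) : Prop :=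
  ∀ t : ℝ, 0 ≤ t → ∑' z : ℤ, absPow α z * ENNReal.ofReal (κ t z) ≤ ENNReal.ofReal t * M

lemma IsStableKernel.exists_momentBound {γ : ℝ} {J : ℤ → ℝ} (hJ : IsStableKernel γ J)
    (hγ₀ : 0 < γ) (hγ₂ : γ < 2) :
    ∃ M : ℝ≥0, ∀ r : ℝ, 0 ≤ r → r ≤ 1 →
      MomentBound (fun t => transitionProb J (r * t)) (γ / 4) M := by
  have hs := hJ.summable_moment hγ₀
  have hM : ∑' z : ℤ, absPow (γ / 4) z * ENNReal.ofReal (J z) =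
      ENNReal.ofReal (∑' z : ℤ, J z * |(z : ℝ)| ^ (γ / 4)) := by
    rw [ENNReal.ofReal_tsum_of_nonneg (fun z => mul_nonneg (hJ.pos z).le (by positivity)) hs]
    refine tsum_congr fun z => ?_
    rw [absPow, ← ENNReal.ofReal_mul (by positivity), mul_comm]
  refine ⟨(∑' z : ℤ, J z * |(z : ℝ)| ^ (γ / 4)).toNNReal, fun r hr hr1 t ht => ?_⟩
  refine (tsum_mul_transitionProb_le (fun x => (hJ.pos x).le) hJ.hasSum_one
    (absPow_zero (by positivity)) (absPow_add_le (by positivity) (by linarith))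
    (mul_nonneg hr ht)).trans ?_
  rw [hM]
  refine mul_le_mul_left (ENNReal.ofReal_le_ofReal ?_) _
  exact mul_le_of_le_one_left ht hr1

section Moment

variable {κ : ℝ → ℤ → ℝ} {μ : Measure Traj} {α : ℝ} {M : ℝ≥0}

lemma IsWalkLaw.lintegral_increment (h : IsWalkLaw κ μ) (w : ℤ → ℝ≥0∞) {s t : ℝ} (hs : 0 ≤ s)
    (ht : 0 ≤ t) : ∫⁻ x, w (x (s + t) - x s) ∂μ = ∑' z, w z * ENNReal.ofReal (κ t z) := by
  have := h.isProbabilityMeasure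
  have hm : Measurable fun x : Traj => x (s + t) - x s :=
    (measurable_eval (s + t)).sub (measurable_eval s)
  rw [← lintegral_map (f := w) (g := fun x : Traj => x (s + t) - x s) measurable_from_top hm,
    lintegral_countable']
  refine tsum_congr fun z => ?_
  rw [Measure.map_apply hm (measurableSet_singleton z), ← h.increment s t hs ht,
    ofReal_measureReal]
  rfl

/-- A random bound for the `α`-th power of the running maximum: a limit of sums of powers of
increments. -/
def maxPow (α T : ℝ) (x : Traj) : ℝ≥0∞ :=
  liminf (fun n : ℕ => ∑ k ∈ Finset.range ⌈T * (n + 1)⌉₊,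
    absPow α (x ((k + 1 : ℝ) / (n + 1)) - x ((k : ℝ) / (n + 1)))) atTop

lemma measurable_absPow_sub (α s t : ℝ) :
    Measurable fun x : Traj => absPow α (x s - x t) :=
  Measurable.comp (g := absPow α) measurable_from_top
    ((measurable_eval s).sub (measurable_eval t))

lemma measurable_maxPow (α T : ℝ) : Measurable (maxPow α T) :=
  Measurable.liminf fun _ => Finset.measurable_sum _ fun _ _ => measurable_absPow_sub _ _ _

/-- Subadditivity of `absPow` telescopes along the grid of mesh `1 / (n + 1)`. By right-continuity
an integer-valued path eventually takes its value at `u` at the first grid point not before `u`. -/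
lemma absPow_le_maxPow (hα : 0 < α) (hα1 : α ≤ 1) (x : Traj) {u T : ℝ} (huT : u ≤ T) :
    absPow α (x u) ≤ maxPow α T x := by
  rcases le_or_gt u 0 with hu | hu
  · rw [x.apply_nonpos hu, absPow_zero hα]; exact bot_le
  refine le_liminf_of_le (by isBoundedDefault) ?_
  have h1 : ∀ᶠ n : ℕ in atTop, x ((⌈u * (n + 1 : ℝ)⌉ : ℝ) / (n + 1)) = x u :=
    (tendsto_ceil x u).eventually_mem ((isOpen_discrete {x u}).mem_nhds rfl)
  filter_upwards [h1] with n hn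
  rw [← hn]
  have hn0 : (0 : ℝ) < n + 1 := by positivity
  have hc : ((⌈u * (n + 1 : ℝ)⌉ : ℤ) : ℝ) = ((⌈u * (n + 1 : ℝ)⌉₊ : ℕ) : ℝ) := 
    (natCast_ceil_eq_intCast_ceil (by positivity)).symm
  rw [hc]
  have h2 : ∀ m : ℕ, absPow α (x ((m : ℝ) / (n + 1))) ≤ ∑ k ∈ Finset.range m,
      absPow α (x ((k + 1 : ℝ) / (n + 1)) - x ((k : ℝ) / (n + 1))) := by
    intro m
    induction m with
    | zero => simp [x.apply_nonpos le_rfl, absPow_zero hα]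
    | succ m ih =>
      rw [Finset.sum_range_succ]
      have := absPow_add_le hα hα1 (x ((m : ℝ) / (n + 1)))
        (x ((m + 1 : ℝ) / (n + 1)) - x ((m : ℝ) / (n + 1)))
      rw [add_sub_cancel] at this
      push_cast
      exact this.trans (by gcongr)
  refine (h2 _).trans ?_
  refine Finset.sum_le_sum_of_subset ?_
  rw [Finset.range_subset_range]
  exact Nat.ceil_mono (by gcongr)

/-- Fatou: at mesh `1 / (n + 1)` there are at most `T (n + 1) + 1` increments, each with moment at
most `M / (n + 1)`. No maximal inequality is needed. -/
lemma lintegral_maxPow_le (h : IsWalkLaw κ μ) (hM : MomentBound κ α M) {T : ℝ} (hT : 0 ≤ T) :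
    ∫⁻ x, maxPow α T x ∂μ ≤ ENNReal.ofReal (T + 1) * M := by
  refine (lintegral_liminf_le fun n => Finset.measurable_sum _ fun _ _ =>
    measurable_absPow_sub _ _ _).trans ?_
  refine liminf_le_of_le (by isBoundedDefault) fun b hb => ?_
  obtain ⟨n, hn⟩ := hb.exists
  refine hn.trans ?_
  rw [lintegral_finsetSum _ fun _ _ => measurable_absPow_sub _ _ _]
  have hn0 : (0 : ℝ) < n + 1 := by positivity
  calc ∑ k ∈ Finset.range ⌈T * (n + 1)⌉₊,
        ∫⁻ x, absPow α (x ((k + 1 : ℝ) / (n + 1)) - x ((k : ℝ) / (n + 1))) ∂μ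
      ≤ ∑ k ∈ Finset.range ⌈T * (n + 1 : ℝ)⌉₊, ENNReal.ofReal (1 / (n + 1 : ℝ)) * M := by
        refine Finset.sum_le_sum fun k _ => ?_
        have := h.lintegral_increment (absPow α) (s := (k : ℝ) / (n + 1))
          (t := 1 / (n + 1 : ℝ)) (by positivity) (by positivity)
        rw [← add_div] at this
        rw [this]
        exact hM _ (by positivity)
    _ = ENNReal.ofReal (⌈T * (n + 1 : ℝ)⌉₊ * (1 / (n + 1 : ℝ))) * M := by
        rw [Finset.sum_const, Finset.card_range, nsmul_eq_mul, ← mul_assoc,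
          ENNReal.ofReal_mul (by positivity), ENNReal.ofReal_natCast]
    _ ≤ _ := by
        gcongr
        rw [mul_one_div, div_le_iff₀ hn0]
        have := (Nat.ceil_lt_add_one (a := T * (n + 1 : ℝ)) (by positivity)).le
        have h0 : (0 : ℝ) ≤ n := by positivity
        nlinarith

/-- A random bound for `log (1 + |x u|)`, `u ≤ T`. -/
def logMax (α T : ℝ) (x : Traj) : ℝ := Real.log (1 + (maxPow α T x).toReal) / α

lemma measurable_logMax (α T : ℝ) : Measurable (logMax α T) :=
  (Real.measurable_log.comp ((measurable_maxPow α T).ennreal_toReal.const_add 1)).div_const α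

lemma logMax_nonneg (hα : 0 < α) (T : ℝ) (x : Traj) : 0 ≤ logMax α T x :=
  div_nonneg (Real.log_nonneg (by linarith [ENNReal.toReal_nonneg (a := maxPow α T x)])) hα.le

lemma log_one_add_abs_le (hα : 0 < α) (hα1 : α ≤ 1) {x : Traj} {T : ℝ}
    (hx : maxPow α T x ≠ ∞) {u : ℝ} (huT : u ≤ T) :
    Real.log (1 + |(x u : ℝ)|) ≤ logMax α T x := by
  have h1 := absPow_le_maxPow hα hα1 x huT
  rw [absPow, ENNReal.ofReal_le_iff_le_toReal hx] at h1
  rw [logMax, le_div_iff₀ hα, mul_comm, ← Real.log_rpow (by positivity)]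
  refine Real.log_le_log (by positivity) ?_
  calc (1 + |(x u : ℝ)|) ^ α ≤ 1 ^ α + |(x u : ℝ)| ^ α :=
        Real.rpow_add_le_add_rpow zero_le_one (abs_nonneg _) hα.le hα1
    _ ≤ _ := by rw [Real.one_rpow]; linarith

lemma maxPow_lintegral_ne_top (h : IsWalkLaw κ μ) (hM : MomentBound κ α M) {T : ℝ}
    (hT : 0 ≤ T) : ∫⁻ x, maxPow α T x ∂μ ≠ ∞ :=
  ((lintegral_maxPow_le h hM hT).trans_lt
    (ENNReal.mul_lt_top ENNReal.ofReal_lt_top ENNReal.coe_lt_top)).ne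

lemma ae_maxPow_ne_top (h : IsWalkLaw κ μ) (hM : MomentBound κ α M) {T : ℝ} (hT : 0 ≤ T) :
    ∀ᵐ x ∂μ, maxPow α T x ≠ ∞ := by
  filter_upwards [ae_lt_top (measurable_maxPow α T) (maxPow_lintegral_ne_top h hM hT)] with x hx
  exact hx.ne

/-- The tangent line of the logarithm at `1 + T`, the order of the mean of `maxPow`; after
integration only `log (1 + T) + M` is left. -/
lemma logMax_le (hα : 0 < α) {T : ℝ} (hT : 0 ≤ T) (x : Traj) :
    logMax α T x ≤ (Real.log (1 + T) + (maxPow α T x).toReal / (1 + T)) / α := by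
  unfold logMax
  gcongr
  have h0 := ENNReal.toReal_nonneg (a := maxPow α T x)
  set R := (maxPow α T x).toReal
  have h1 := Real.log_le_sub_one_of_pos (x := (1 + R) / (1 + T)) (by positivity)
  rw [Real.log_div (by positivity) (by positivity)] at h1
  have h2 : (1 + R) / (1 + T) - 1 ≤ R / (1 + T) := by
    rw [div_sub_one (by positivity)]
    gcongr
    linarith
  linarith

lemma integrable_maxPow (h : IsWalkLaw κ μ) (hM : MomentBound κ α M) {T : ℝ} (hT : 0 ≤ T) :
    Integrable (fun x => (maxPow α T x).toReal) μ :=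
  integrable_toReal_of_lintegral_ne_top (measurable_maxPow α T).aemeasurable
    (maxPow_lintegral_ne_top h hM hT)

lemma integrable_logMax (hα : 0 < α) (h : IsWalkLaw κ μ) (hM : MomentBound κ α M) {T : ℝ}
    (hT : 0 ≤ T) : Integrable (logMax α T) μ := by
  have := h.isProbabilityMeasure
  refine Integrable.mono' (((integrable_const (Real.log (1 + T))).add
    ((integrable_maxPow h hM hT).div_const (1 + T))).div_const α)
    (measurable_logMax α T).aestronglyMeasurable (Eventually.of_forall fun x => ?_)
  rw [Real.norm_of_nonneg (logMax_nonneg hα T x)]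
  exact logMax_le hα hT x

lemma integral_logMax_le (hα : 0 < α) (h : IsWalkLaw κ μ) (hM : MomentBound κ α M) {T : ℝ}
    (hT : 0 ≤ T) : ∫ x, logMax α T x ∂μ ≤ (Real.log (1 + T) + M) / α := by
  have := h.isProbabilityMeasure
  have hi := (integrable_maxPow h hM hT).div_const (1 + T)
  calc ∫ x, logMax α T x ∂μ
      ≤ ∫ x, (Real.log (1 + T) + (maxPow α T x).toReal / (1 + T)) / α ∂μ :=
        integral_mono (integrable_logMax hα h hM hT)
          (((integrable_const (Real.log (1 + T))).add hi).div_const α)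
          fun x => logMax_le hα hT x
    _ = (Real.log (1 + T) + (∫ x, (maxPow α T x).toReal ∂μ) / (1 + T)) / α := by
        rw [integral_div, integral_add (integrable_const _) hi, integral_div]
        simp
    _ ≤ _ := by
        gcongr
        rw [div_le_iff₀ (by positivity), integral_toReal (measurable_maxPow α T).aemeasurable
          (ae_lt_top (measurable_maxPow α T) (maxPow_lintegral_ne_top h hM hT))]
        have := ENNReal.toReal_mono (by finiteness) (lintegral_maxPow_le h hM hT)
        rw [ENNReal.toReal_mul, ENNReal.toReal_ofReal (by positivity), ENNReal.coe_toReal] at this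
        linarith

/-- A first-moment Borel–Cantelli argument: the weighted series converges almost surely, so
eventually `maxPow α n ≤ (n + 1) ^ 3`. -/
lemma ae_tendsto_logMax (hα : 0 < α) (h : IsWalkLaw κ μ) (hM : MomentBound κ α M) :
    ∀ᵐ x ∂μ, Tendsto (fun n : ℕ => logMax α n x / n) atTop (𝓝 0) := by
  -- The mean of `maxPow α n` is at most `(n + 1) M`, so the cubic weight leaves a convergent
  -- series.
  have hsum : ∑' n : ℕ, ∫⁻ x, maxPow α n x * ENNReal.ofReal (1 / (n + 1 : ℝ) ^ 3) ∂μ ≠ ∞ := by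
    have hs : Summable fun n : ℕ => (M : ℝ) * (1 / (n + 1 : ℝ) ^ 2) := by
      have := (summable_nat_add_iff 1).2 (Real.summable_one_div_nat_pow.2 one_lt_two)
      simpa using this.mul_left (M : ℝ)
    refine ne_top_of_le_ne_top (ENNReal.ofReal_ne_top (r := ∑' n : ℕ, (M : ℝ) *
      (1 / (n + 1 : ℝ) ^ 2))) ?_
    rw [ENNReal.ofReal_tsum_of_nonneg (fun n => by positivity) hs]
    refine ENNReal.tsum_le_tsum fun n => ?_
    rw [lintegral_mul_const _ (measurable_maxPow α n)]
    calc (∫⁻ x, maxPow α n x ∂μ) * ENNReal.ofReal (1 / (n + 1 : ℝ) ^ 3)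
        ≤ (ENNReal.ofReal (n + 1) * M) * ENNReal.ofReal (1 / (n + 1 : ℝ) ^ 3) := by
          gcongr
          exact lintegral_maxPow_le h hM (by positivity)
      _ = _ := by
          rw [← ENNReal.ofReal_coe_nnreal, ← ENNReal.ofReal_mul (by positivity),
            ← ENNReal.ofReal_mul (by positivity)]
          congr 1
          field_simp
  rw [← lintegral_tsum fun n : ℕ => ((measurable_maxPow α n).mul_const _).aemeasurable] at hsum
  have hlog : Tendsto (fun n : ℕ => (Real.log 2 + 3 * Real.log (n + 1)) / α / n) atTop
      (𝓝 0) := by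
    have h1 : Tendsto (fun n : ℕ => Real.log (n + 1 : ℝ) / n) atTop (𝓝 0) := by
      have := (Real.isLittleO_log_id_atTop.tendsto_div_nhds_zero).comp
        (tendsto_natCast_atTop_atTop.comp (tendsto_add_atTop_nat 1) :
          Tendsto (fun n : ℕ => ((n + 1 : ℕ) : ℝ)) atTop atTop)
      have h2 := this.mul (tendsto_const_nhds.add (tendsto_one_div_atTop_nhds_zero_nat (𝕜 := ℝ)) :
        Tendsto (fun n : ℕ => (1 : ℝ) + 1 / n) atTop (𝓝 (1 + 0)))
      rw [zero_mul] at h2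
      refine h2.congr' ?_
      filter_upwards [eventually_gt_atTop 0] with n hn
      have hn' : (0 : ℝ) < n := by exact_mod_cast hn
      simp only [Function.comp, id]
      push_cast
      field_simp
    have h3 := ((tendsto_const_div_atTop_nhds_zero_nat (Real.log 2 / α)).add
      (h1.const_mul (3 / α)))
    simp only [mul_zero, add_zero] at h3
    refine h3.congr fun n => ?_
    ring
  filter_upwards [ae_lt_top (Measurable.tsum fun n : ℕ => (measurable_maxPow α n).mul_const _)
    hsum] with x hx
  have ht := ENNReal.tendsto_atTop_zero_of_tsum_ne_top hx.ne
  refine tendsto_of_tendsto_of_tendsto_of_le_of_le' tendsto_const_nhds hlog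
    (Eventually.of_forall fun n => div_nonneg (logMax_nonneg hα _ x) (by positivity)) ?_
  filter_upwards [ht.eventually (ge_mem_nhds (by norm_num : (0 : ℝ≥0∞) < 1))] with n hn
  unfold logMax
  gcongr
  have h1 : (maxPow α n x).toReal ≤ (n + 1 : ℝ) ^ 3 := by
    have := ENNReal.toReal_mono ENNReal.one_ne_top hn
    rw [ENNReal.toReal_mul, ENNReal.toReal_ofReal (by positivity), ENNReal.toReal_one,
      mul_one_div, div_le_one (by positivity)] at this
    exact this
  have h2 : (1 : ℝ) ≤ (n + 1 : ℝ) ^ 3 := one_le_pow₀ (by linarith [Nat.cast_nonneg (α := ℝ) n])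
  calc Real.log (1 + (maxPow α n x).toReal) ≤ Real.log (2 * (n + 1 : ℝ) ^ 3) :=
        Real.log_le_log (by positivity) (by linarith)
    _ = _ := by
        rw [Real.log_mul (by norm_num) (by positivity), Real.log_pow]
        norm_num

end Moment

/-! ### Lower bounds on transition probabilities -/

/-- Lower bounds on the increment laws: at fixed time, and polynomially in time. -/
structure KernelLowerBound (κ : ℝ → ℤ → ℝ) (C K : ℝ) : Prop where
  pos : ∀ t : ℝ, 0 < t → ∀ z : ℤ, 0 < κ t z
  fixed : ∀ t : ℝ, 0 < t → ∃ A : ℝ, ∀ z : ℤ, -Real.log (κ t z) ≤ A + 4 * Real.log (1 + |(z : ℝ)|)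
  nonneg : 0 ≤ K
  long : ∀ t : ℝ, 1 ≤ t → ∀ z : ℤ,
    -Real.log (κ t z) ≤ C + K * Real.log t + 4 * Real.log (1 + |(z : ℝ)|)

section KernelEstimates

variable {κ : ℝ → ℤ → ℝ} {μ : Measure Traj}

lemma IsWalkLaw.chapman_kolmogorov (h : IsWalkLaw κ μ) {s t : ℝ} (hs : 0 ≤ s) (ht : 0 ≤ t)
    (z : ℤ) : ENNReal.ofReal (κ (s + t) z) = ∫⁻ x, ENNReal.ofReal (κ t (z - x s)) ∂μ := by
  set Φ : Traj × Traj → ℝ≥0∞ := fun p => if p.1 s + p.2 t = z then 1 else 0 with hΦ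
  have hΦm : Measurable Φ := Measurable.ite (measurableSet_eq_fun
    (((measurable_eval s).comp measurable_fst).add ((measurable_eval t).comp measurable_snd))
    measurable_const) measurable_const measurable_const
  have hind : ∀ (f : Traj → ℤ) (_ : Measurable f) (w : ℤ),
      ∫⁻ x, (if f x = w then (1 : ℝ≥0∞) else 0) ∂μ = μ {x | f x = w} := by
    intro f hf w
    have hm : MeasurableSet {x | f x = w} := hf (measurableSet_singleton w)
    rw [← lintegral_indicator_one hm]
    refine lintegral_congr fun x => ?_
    by_cases hx : f x = w <;> simp [hx]
  calc ENNReal.ofReal (κ (s + t) z) = ∫⁻ x, Φ (stopAt s x, shift s x) ∂μ := by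
        rw [← h.measure_eval_eq (by positivity), ← hind _ (measurable_eval _)]
        refine lintegral_congr fun x => ?_
        simp only [hΦ, stopAt_apply_of_le x le_rfl, shift_apply s x ht, add_sub_cancel]
    _ = ∫⁻ x, ∫⁻ x', Φ (stopAt s x, x') ∂μ ∂μ := h.lintegral_stopAt_shift hs hΦm
    _ = _ := by
        refine lintegral_congr fun x => ?_
        rw [← h.measure_eval_eq ht, ← hind _ (measurable_eval _)]
        refine lintegral_congr fun x' => ?_
        simp only [hΦ, stopAt_apply_of_le x le_rfl]
        exact if_congr ⟨fun e => by linarith, fun e => by linarith⟩ rfl rfl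

/-- With probability at least one half the walk is at distance `O(t ^ (1 / α))`. -/
lemma IsWalkLaw.half_le_measure (h : IsWalkLaw κ μ) {α : ℝ} {M : ℝ≥0} (hα : 0 < α)
    (hM : MomentBound κ α M) {s t : ℝ} (hs : 0 ≤ s) (hst : s ≤ t) (ht : 0 < t) :
    1 / 2 ≤ μ {x | |(x s : ℝ)| ≤ (2 * t * (M + 1)) ^ (1 / α)} := by
  have := h.isProbabilityMeasure
  have hm0 : Measurable fun x : Traj => absPow α (x s) :=
    Measurable.comp (g := absPow α) measurable_from_top (measurable_eval s)
  have hE : ∫⁻ x, absPow α (x s) ∂μ ≤ ENNReal.ofReal (t * (M + 1)) := by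
    have e := h.lintegral_increment (absPow α) le_rfl hs
    simp only [zero_add, Traj.apply_nonpos _ le_rfl, sub_zero] at e
    rw [e, ENNReal.ofReal_mul ht.le]
    refine (hM s hs).trans ?_
    gcongr
    rw [← ENNReal.ofReal_coe_nnreal]
    exact ENNReal.ofReal_le_ofReal (by linarith)
  have hpos : (0 : ℝ) < t * (M + 1) := by positivity
  -- Markov's inequality at twice the moment bound.
  have hbad := mul_meas_ge_le_lintegral (μ := μ) hm0 (ENNReal.ofReal (2 * t * (M + 1)))
  have hbad2 : μ {x : Traj | ENNReal.ofReal (2 * t * (M + 1)) ≤ absPow α (x s)} ≤ 1 / 2 := by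
    have h1 := hbad.trans hE
    generalize μ {x : Traj | ENNReal.ofReal (2 * t * (M + 1)) ≤ absPow α (x s)} = m at h1 ⊢
    have h2 : ENNReal.ofReal (2 * t * (M + 1)) = ENNReal.ofReal (t * (M + 1)) * 2 := by
      rw [mul_assoc, mul_comm, ENNReal.ofReal_mul (by positivity), ENNReal.ofReal_ofNat]
    have h3 : ENNReal.ofReal (t * (M + 1)) * (2 * m) ≤ ENNReal.ofReal (t * (M + 1)) * 1 := by
      rwa [← mul_assoc, ← h2, mul_one]
    rw [ENNReal.mul_le_mul_iff_right (ENNReal.ofReal_pos.2 hpos).ne' ENNReal.ofReal_ne_top] at h3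
    rwa [ENNReal.le_div_iff_mul_le (by simp) (by simp), mul_comm]
  have hmeas : MeasurableSet {x : Traj | ENNReal.ofReal (2 * t * (M + 1)) ≤ absPow α (x s)} :=
    measurableSet_le measurable_const hm0
  have hcompl := prob_compl_eq_one_sub (μ := μ) hmeas
  calc (1 / 2 : ℝ≥0∞) = 1 - 1 / 2 := by simp
    _ ≤ 1 - μ {x : Traj | ENNReal.ofReal (2 * t * (M + 1)) ≤ absPow α (x s)} :=
        tsub_le_tsub_left hbad2 1
    _ = _ := hcompl.symm
    _ ≤ _ := by
        refine measure_mono fun x hx => ?_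
        simp only [Set.mem_compl_iff, Set.mem_ofPred_eq, not_le, absPow] at hx ⊢
        have h3 := (ENNReal.ofReal_lt_ofReal_iff (by positivity)).1 hx
        calc |(x s : ℝ)| = (|(x s : ℝ)| ^ α) ^ (1 / α) := by
              rw [← Real.rpow_mul (abs_nonneg _), mul_one_div_cancel hα.ne', Real.rpow_one]
          _ ≤ _ := Real.rpow_le_rpow (by positivity) h3.le (by positivity)

/-- At a fixed time a single jump suffices, but its bound carries `exp (-(r * t))`. For large `t`
the walk runs freely until `t - 1`, stays within `O(t ^ (1 / α))` with probability one half, and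
reaches `z` during the last unit of time. The fourth power of that distance gives `K = 4 / α`. -/
lemma exists_kernelLowerBound {γ : ℝ} {J : ℤ → ℝ} (hJ : IsStableKernel γ J) (hγ₂ : γ < 2)
    {r : ℝ} (hr : 0 < r) {α : ℝ} (hα : 0 < α) {M : ℝ≥0}
    (hM : MomentBound (fun t => transitionProb J (r * t)) α M)
    (hμ : IsWalkLaw (fun t => transitionProb J (r * t)) μ) :
    ∃ C K : ℝ, KernelLowerBound (fun t => transitionProb J (r * t)) C K := by
  have := hμ.isProbabilityMeasure
  obtain ⟨c, hc, hcJ⟩ := hJ.exists_polynomial_le hγ₂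
  have hlow : ∀ t : ℝ, 0 < t → ∀ z : ℤ,
      Real.exp (-(r * t)) * (r * t) * c * ((1 + |(z : ℝ)|) ^ 4)⁻¹ ≤ transitionProb J (r * t) z := by
    intro t ht z
    refine le_trans ?_ (le_transitionProb (fun x => (hJ.pos x).le) hJ.hasSum_one
      (by positivity : 0 ≤ r * t) z)
    rw [mul_assoc (Real.exp (-(r * t)) * (r * t))]
    exact mul_le_mul_of_nonneg_left (hcJ z) (by positivity)
  set c₁ := Real.exp (-(r * 1)) * (r * 1) * c with hc₁
  have hc₁0 : 0 < c₁ := by positivity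
  set D : ℝ := 2 * (M + 1) with hD
  have hD1 : 1 ≤ D := by rw [hD]; nlinarith [M.coe_nonneg]
  refine ⟨Real.log 2 - Real.log c₁ + 4 * (Real.log 2 + Real.log D / α), 4 / α, ?_, ?_,
    by positivity, ?_⟩
  · intro t ht z
    exact lt_of_lt_of_le (by positivity) (hlow t ht z)
  · intro t ht
    refine ⟨-Real.log (Real.exp (-(r * t)) * (r * t) * c), fun z => ?_⟩
    have h1 := Real.log_le_log (by positivity) (hlow t ht z)
    rw [Real.log_mul (by positivity) (by positivity), Real.log_inv, Real.log_pow] at h1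
    push_cast at h1
    linarith
  · intro t ht z
    have ht0 : 0 < t := by linarith
    set B : ℝ := (2 * t * (M + 1)) ^ (1 / α) with hB
    have hB1 : 1 ≤ B := Real.one_le_rpow (by nlinarith [M.coe_nonneg]) (by positivity)
    have hlogB : Real.log B = (Real.log D + Real.log t) / α := by
      rw [hB, Real.log_rpow (by positivity), show 2 * t * (M + 1 : ℝ) = D * t by rw [hD]; ring,
        Real.log_mul (by positivity) (by positivity)]
      ring
    have key : c₁ * ((1 + |(z : ℝ)| + B) ^ 4)⁻¹ * (1 / 2) ≤ transitionProb J (r * t) z := by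
      have hCK := hμ.chapman_kolmogorov (sub_nonneg.2 ht) zero_le_one z
      have hhalf := hμ.half_le_measure hα hM (sub_nonneg.2 ht) (by linarith : t - 1 ≤ t) ht0
      rw [sub_add_cancel] at hCK
      have hp : 0 ≤ transitionProb J (r * t) z := le_trans (by positivity) (hlow t ht0 z)
      rw [← ENNReal.ofReal_le_ofReal_iff hp, hCK, ENNReal.ofReal_mul (by positivity)]
      have hAm : MeasurableSet {x : Traj | |(x (t - 1) : ℝ)| ≤ B} :=
        (measurable_eval (t - 1)) (show MeasurableSet {w : ℤ | |(w : ℝ)| ≤ B} from trivial)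
      calc ENNReal.ofReal (c₁ * ((1 + |(z : ℝ)| + B) ^ 4)⁻¹) * ENNReal.ofReal (1 / 2)
          ≤ ENNReal.ofReal (c₁ * ((1 + |(z : ℝ)| + B) ^ 4)⁻¹) *
              μ {x : Traj | |(x (t - 1) : ℝ)| ≤ B} := by
            gcongr
            refine le_trans (le_of_eq ?_) hhalf
            rw [ENNReal.ofReal_div_of_pos two_pos, ENNReal.ofReal_one, ENNReal.ofReal_ofNat]
        _ = ∫⁻ _ in {x : Traj | |(x (t - 1) : ℝ)| ≤ B},
              ENNReal.ofReal (c₁ * ((1 + |(z : ℝ)| + B) ^ 4)⁻¹) ∂μ := by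
            rw [setLIntegral_const]
        _ ≤ ∫⁻ x in {x : Traj | |(x (t - 1) : ℝ)| ≤ B},
              ENNReal.ofReal (transitionProb J (r * 1) (z - x (t - 1))) ∂μ := by
            refine setLIntegral_mono' hAm fun x hx => ENNReal.ofReal_le_ofReal ?_
            refine le_trans ?_ (hlow 1 one_pos (z - x (t - 1)))
            have hx' : |(x (t - 1) : ℝ)| ≤ B := hx
            have habs : |((z - x (t - 1) : ℤ) : ℝ)| ≤ |(z : ℝ)| + B := by
              push_cast
              exact (abs_sub _ _).trans (by linarith)
            exact mul_le_mul_of_nonneg_left (inv_anti₀ (by positivity)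
              (pow_le_pow_left₀ (by positivity) (by linarith) 4)) hc₁0.le
        _ ≤ _ := setLIntegral_le_lintegral _ _
    have h1 := Real.log_le_log (by positivity) key
    rw [Real.log_mul (by positivity) (by positivity), Real.log_mul (by positivity) (by positivity),
      Real.log_inv, Real.log_pow, one_div, Real.log_inv] at h1
    push_cast at h1
    have h2 : Real.log (1 + |(z : ℝ)| + B) ≤ Real.log (1 + |(z : ℝ)|) +
        (Real.log 2 + Real.log B) := by
      rw [← Real.log_mul two_ne_zero (by positivity), ← Real.log_mul (by positivity) (by positivity)]
      refine Real.log_le_log (by positivity) ?_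
      nlinarith [abs_nonneg (z : ℝ)]
    rw [hlogB] at h2
    have h3 : (Real.log D + Real.log t) / α = Real.log D / α + 1 / α * Real.log t := by ring
    rw [h3] at h2
    have h4 : 4 / α * Real.log t = 4 * (1 / α * Real.log t) := by ring
    rw [h4]
    linarith

end KernelEstimates

/-! ### Pathwise inequalities for the logarithms -/

/-- The standing assumptions: `μ` and `ν` are laws of walks with increments `κ` and `κ'`, where `κ`
satisfies lower bounds and `κ'` has some finite moment. -/
structure PinningModel (κ κ' : ℝ → ℤ → ℝ) (μ ν : Measure Traj) (β α : ℝ) (M : ℝ≥0) (C K : ℝ) :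
    Prop where
  left : IsWalkLaw κ μ
  right : IsWalkLaw κ' ν
  beta_nonneg : 0 ≤ β
  alpha_pos : 0 < α
  alpha_le_one : α ≤ 1
  lower : KernelLowerBound κ C K
  moment : MomentBound κ' α M

/-- The logarithm of the free partition function with optimal starting point. -/
def logFree (μ : Measure Traj) (β T : ℝ) (y : Traj) : ℝ := Real.log (freeSup μ β y T).toReal

/-- The logarithm of the pinned partition function. -/
def logPinned (μ : Measure Traj) (β T : ℝ) (y : Traj) : ℝ := Real.log (pinned μ β y T).toReal

lemma logFree_stopAt (μ : Measure Traj) (β : ℝ) {T : ℝ} (hT : 0 ≤ T) (y : Traj) :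
    logFree μ β T (stopAt T y) = logFree μ β T y := by
  rw [logFree, freeSup_stopAt μ β y hT, logFree]

lemma logPinned_stopAt (μ : Measure Traj) (β : ℝ) {T : ℝ} (hT : 0 ≤ T) (y : Traj) :
    logPinned μ β T (stopAt T y) = logPinned μ β T y := by
  rw [logPinned, pinned_stopAt μ β y hT, logPinned]

namespace PinningModel

variable {κ κ' : ℝ → ℤ → ℝ} {μ ν : Measure Traj} {β α : ℝ} {M : ℝ≥0} {C K : ℝ}

section Pathwise

variable (h : PinningModel κ κ' μ ν β α M C K)
include h

lemma measurable_logFree (T : ℝ) : Measurable (logFree μ β T) := by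
  have := h.left.isProbabilityMeasure
  exact Real.measurable_log.comp (measurable_freeSup μ β T).ennreal_toReal

lemma measurable_logPinned (T : ℝ) : Measurable (logPinned μ β T) := by
  have := h.left.isProbabilityMeasure
  exact Real.measurable_log.comp (measurable_pinned μ β T).ennreal_toReal

lemma freeSup_ne_top (y : Traj) {T : ℝ} (hT : 0 ≤ T) : freeSup μ β y T ≠ ∞ := by
  have := h.left.isProbabilityMeasure
  exact ((freeSup_le h.beta_nonneg y hT).trans_lt ENNReal.ofReal_lt_top).ne

lemma one_le_toReal_free (y : Traj) {T : ℝ} (hT : 0 ≤ T) : 1 ≤ (free μ β 0 y T).toReal := by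
  have := h.left.isProbabilityMeasure
  have := ENNReal.toReal_mono (ne_top_of_le_ne_top (h.freeSup_ne_top y hT)
    (free_le_freeSup 0 y T)) (one_le_free (μ := μ) h.beta_nonneg 0 y hT)
  simpa using this

lemma toReal_free_le (y : Traj) {T : ℝ} (hT : 0 ≤ T) :
    (free μ β 0 y T).toReal ≤ (freeSup μ β y T).toReal :=
  ENNReal.toReal_mono (h.freeSup_ne_top y hT) (free_le_freeSup 0 y T)

lemma toReal_freeSup_pos (y : Traj) {T : ℝ} (hT : 0 ≤ T) : 0 < (freeSup μ β y T).toReal :=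
  zero_lt_one.trans_le ((h.one_le_toReal_free y hT).trans (h.toReal_free_le y hT))

lemma logFree_nonneg (y : Traj) {T : ℝ} (hT : 0 ≤ T) : 0 ≤ logFree μ β T y :=
  Real.log_nonneg ((h.one_le_toReal_free y hT).trans (h.toReal_free_le y hT))

lemma logFree_le (y : Traj) {T : ℝ} (hT : 0 ≤ T) : logFree μ β T y ≤ β * T := by
  have := h.left.isProbabilityMeasure
  rw [logFree, Real.log_le_iff_le_exp (h.toReal_freeSup_pos y hT)]
  exact ENNReal.toReal_le_of_le_ofReal (Real.exp_nonneg _) (freeSup_le h.beta_nonneg y hT)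

lemma pinned_ne_top (y : Traj) {T : ℝ} (hT : 0 ≤ T) : pinned μ β y T ≠ ∞ :=
  ne_top_of_le_ne_top (h.freeSup_ne_top y hT) ((pinned_le_free y T).trans (free_le_freeSup 0 y T))

lemma kernel_le_toReal_pinned (y : Traj) {T : ℝ} (hT : 0 < T) :
    κ T (y T) ≤ (pinned μ β y T).toReal := by
  rw [← ENNReal.ofReal_le_iff_le_toReal (h.pinned_ne_top y hT.le)]
  exact ofReal_le_pinned h.left h.beta_nonneg y hT.le

lemma toReal_pinned_pos (y : Traj) {T : ℝ} (hT : 0 < T) : 0 < (pinned μ β y T).toReal :=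
  (h.lower.pos T hT _).trans_le (h.kernel_le_toReal_pinned y hT)

lemma toReal_pinned_le_free (y : Traj) {T : ℝ} (hT : 0 ≤ T) :
    (pinned μ β y T).toReal ≤ (free μ β 0 y T).toReal :=
  ENNReal.toReal_mono (ne_top_of_le_ne_top (h.freeSup_ne_top y hT) (free_le_freeSup 0 y T))
    (pinned_le_free y T)

lemma logPinned_le_log_free (y : Traj) {T : ℝ} (hT : 0 < T) :
    logPinned μ β T y ≤ Real.log (free μ β 0 y T).toReal :=
  Real.log_le_log (h.toReal_pinned_pos y hT) (h.toReal_pinned_le_free y hT.le)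

lemma log_free_le_logFree (y : Traj) {T : ℝ} (hT : 0 ≤ T) :
    Real.log (free μ β 0 y T).toReal ≤ logFree μ β T y :=
  Real.log_le_log (zero_lt_one.trans_le (h.one_le_toReal_free y hT)) (h.toReal_free_le y hT)

lemma logPinned_le_logFree (y : Traj) {T : ℝ} (hT : 0 < T) :
    logPinned μ β T y ≤ logFree μ β T y :=
  (h.logPinned_le_log_free y hT).trans (h.log_free_le_logFree y hT.le)

lemma log_kernel_le_logPinned (y : Traj) {T : ℝ} (hT : 0 < T) :
    Real.log (κ T (y T)) ≤ logPinned μ β T y :=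
  Real.log_le_log (h.lower.pos T hT _) (h.kernel_le_toReal_pinned y hT)

lemma logFree_add_le (y : Traj) {s t : ℝ} (hs : 0 ≤ s) (ht : 0 ≤ t) :
    logFree μ β (s + t) y ≤ logFree μ β s y + logFree μ β t (shift s y) := by
  unfold logFree
  rw [← Real.log_mul (h.toReal_freeSup_pos y hs).ne' (h.toReal_freeSup_pos _ ht).ne',
    ← ENNReal.toReal_mul]
  refine Real.log_le_log (h.toReal_freeSup_pos y (by positivity)) (ENNReal.toReal_mono ?_
    (freeSup_add_le h.left y hs ht))
  exact ENNReal.mul_ne_top (h.freeSup_ne_top y hs) (h.freeSup_ne_top _ ht)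

lemma logPinned_add_le (y : Traj) {s t : ℝ} (hs : 0 < s) (ht : 0 < t) :
    logPinned μ β s y + logPinned μ β t (shift s y) ≤ logPinned μ β (s + t) y := by
  unfold logPinned
  rw [← Real.log_mul (h.toReal_pinned_pos y hs).ne' (h.toReal_pinned_pos _ ht).ne',
    ← ENNReal.toReal_mul]
  refine Real.log_le_log ?_ (ENNReal.toReal_mono (h.pinned_ne_top y (by positivity))
    (mul_pinned_le h.left y hs.le ht.le))
  rw [ENNReal.toReal_mul]
  exact mul_pos (h.toReal_pinned_pos y hs) (h.toReal_pinned_pos _ ht)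

lemma logFree_mul_le (y : Traj) {k : ℝ} (hk : 0 ≤ k) (n : ℕ) :
    logFree μ β (n * k) y ≤ ∑ j ∈ Finset.range n, logFree μ β k (shift (j * k) y) := by
  induction n with
  | zero => simpa using h.logFree_le y le_rfl
  | succ n ih =>
    rw [Finset.sum_range_succ, Nat.cast_succ, add_mul, one_mul]
    exact (h.logFree_add_le y (by positivity) hk).trans (by gcongr)

lemma sum_le_logPinned_mul (y : Traj) {k : ℝ} (hk : 0 < k) (n : ℕ) :
    ∑ j ∈ Finset.range (n + 1), logPinned μ β k (shift (j * k) y) ≤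
      logPinned μ β ((n + 1 : ℕ) * k) y := by
  induction n with
  | zero => simp [shift_zero]
  | succ n ih =>
    rw [Finset.sum_range_succ, Nat.cast_succ (n + 1), add_mul _ _ k, one_mul]
    exact le_trans (by gcongr) (h.logPinned_add_le y (by positivity) hk)

/-- Lower bound on the kernel at a displacement of the trajectory `y`. -/
lemma neg_log_kernel_sub_le {y : Traj} {S : ℝ} (hy : maxPow α S y ≠ ∞) {s t T : ℝ}
    (hs : s ≤ S) (hst : s + t ≤ S) (ht : 1 ≤ t) (htT : t ≤ T) :
    -Real.log (κ t (y (s + t) - y s)) ≤ C + K * Real.log T + 8 * logMax α S y := by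
  have h1 := h.lower.long t ht (y (s + t) - y s)
  have h2 := log_one_add_abs_le h.alpha_pos h.alpha_le_one hy hs
  have h3 := log_one_add_abs_le h.alpha_pos h.alpha_le_one hy hst
  have h4 : Real.log (1 + |((y (s + t) - y s : ℤ) : ℝ)|) ≤
      Real.log (1 + |(y (s + t) : ℝ)|) + Real.log (1 + |(y s : ℝ)|) := by
    rw [← Real.log_mul (by positivity) (by positivity)]
    refine Real.log_le_log (by positivity) ?_
    push_cast
    nlinarith [abs_sub (y (s + t) : ℝ) (y s), abs_nonneg (y (s + t) : ℝ), abs_nonneg (y s : ℝ)]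
  have h5 : K * Real.log t ≤ K * Real.log T :=
    mul_le_mul_of_nonneg_left (Real.log_le_log (by linarith) htT) h.lower.nonneg
  linarith

lemma logPinned_shift_ge {y : Traj} {S : ℝ} (hy : maxPow α S y ≠ ∞) {s t T : ℝ}
    (hs : s ≤ S) (hst : s + t ≤ S) (ht : 1 ≤ t) (htT : t ≤ T) :
    -(C + K * Real.log T + 8 * logMax α S y) ≤ logPinned μ β t (shift s y) := by
  have h1 := h.neg_log_kernel_sub_le hy hs hst ht htT
  have h2 := h.log_kernel_le_logPinned (shift s y) (by linarith : 0 < t)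
  rw [shift_apply s y (by linarith)] at h2
  linarith

/-- Comparison of the free and pinned partition functions. -/
lemma logFree_shift_le {y : Traj} {T : ℝ} (hT : 0 ≤ T) (hy : maxPow α (T + 2) y ≠ ∞) :
    logFree μ β T (shift 1 y) ≤ logPinned μ β (T + 2) y + 2 * Real.log (1 + β * T) +
      2 * (C + K * Real.log (T + 2) + 8 * logMax α (T + 2) y) := by
  -- `exp (-E)` bounds from below the pinned partition function of every interval of length at least
  -- 1 inside `[0, T + 2]`.
  set E := C + K * Real.log (T + 2) + 8 * logMax α (T + 2) y with hE
  have hβT : 0 < 1 + β * T := by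
    have := mul_nonneg h.beta_nonneg hT
    linarith
  have hkey : ∀ s t, 0 ≤ s → 1 ≤ t → s + t ≤ T + 2 →
      ENNReal.ofReal (Real.exp (-E)) ≤ pinned μ β (shift s y) t := by
    intro s t hs ht hst
    rw [ENNReal.ofReal_le_iff_le_toReal (h.pinned_ne_top _ (by linarith)),
      ← Real.le_log_iff_exp_le (h.toReal_pinned_pos _ (by linarith))]
    exact h.logPinned_shift_ge hy (by linarith) hst ht (by linarith)
  set c : ℝ≥0∞ := ENNReal.ofReal (Real.exp (2 * E)) * pinned μ β y (T + 2) with hc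
  -- The stretch from `1 + u` to `1 + u + v` is completed on both sides to `[0, T + 2]`. The margins
  -- of length 1 ensure that both added pieces have length at least 1, where the kernel bound is
  -- uniform.
  have hpc : ∀ u v, 0 ≤ u → 0 ≤ v → u + v ≤ T → pinned μ β (shift u (shift 1 y)) v ≤ c := by
    intro u v hu hv huv
    rw [shift_shift hu]
    have e1 := mul_pinned_le (β := β) h.left y (by positivity : 0 ≤ 1 + u)
      (by linarith : 0 ≤ T + 1 - u)
    have e2 := mul_pinned_le (β := β) h.left (shift (1 + u) y) hv
      (by linarith : 0 ≤ T + 1 - u - v)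
    rw [shift_shift hv] at e2
    have k1 := hkey 0 (1 + u) le_rfl (by linarith) (by linarith)
    have k2 := hkey (1 + u + v) (T + 1 - u - v) (by positivity) (by linarith) (by linarith)
    rw [shift_zero] at k1
    rw [show v + (T + 1 - u - v) = T + 1 - u by ring] at e2
    rw [show 1 + u + (T + 1 - u) = T + 2 by ring] at e1
    have hone : ENNReal.ofReal (Real.exp (2 * E)) *
        (ENNReal.ofReal (Real.exp (-E)) * ENNReal.ofReal (Real.exp (-E))) = 1 := by
      rw [← ENNReal.ofReal_mul (by positivity), ← ENNReal.ofReal_mul (by positivity),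
        ← Real.exp_add, ← Real.exp_add, ← ENNReal.ofReal_one, ← Real.exp_zero]
      congr 2
      ring
    calc pinned μ β (shift (1 + u) y) v
        = ENNReal.ofReal (Real.exp (2 * E)) * (ENNReal.ofReal (Real.exp (-E)) *
            (pinned μ β (shift (1 + u) y) v * ENNReal.ofReal (Real.exp (-E)))) := by
          rw [mul_comm (pinned μ β (shift (1 + u) y) v), ← mul_assoc, ← mul_assoc,
            mul_assoc (ENNReal.ofReal (Real.exp (2 * E))), hone, one_mul]
      _ ≤ c := by
          rw [hc]
          gcongr
          refine le_trans ?_ e1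
          gcongr
          refine le_trans ?_ e2
          gcongr
  -- The degenerate stretch `u = v = 0` has pinned partition function 1.
  have hc1 : 1 ≤ c := by
    refine le_trans ?_ (hpc 0 0 le_rfl le_rfl (by linarith))
    have := h.left.isProbabilityMeasure
    have e : ∀ x, pinnedWeight β x (shift 0 (shift 1 y)) 0 = 1 := fun x => by
      simp [pinnedWeight, weight, energy, Traj.apply_nonpos]
    simp [pinned, e]
  have hmain := freeSup_le_of_pinned h.left h.beta_nonneg (shift 1 y) hT hc1 hpc
  have hctop : c ≠ ∞ :=
    ENNReal.mul_ne_top ENNReal.ofReal_ne_top (h.pinned_ne_top y (by linarith))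
  have hlog := Real.log_le_log (h.toReal_freeSup_pos _ hT)
    (ENNReal.toReal_mono (ENNReal.mul_ne_top ENNReal.ofReal_ne_top hctop) hmain)
  have hp := h.toReal_pinned_pos y (by linarith : 0 < T + 2)
  rw [ENNReal.toReal_mul, hc, ENNReal.toReal_mul, ENNReal.toReal_ofReal (by positivity),
    ENNReal.toReal_ofReal (by positivity), Real.log_mul (by positivity) (by positivity),
    Real.log_mul (by positivity) hp.ne', Real.log_exp, Real.log_pow] at hlog
  push_cast at hlog
  unfold logFree
  unfold logPinned
  linarith

end Pathwise

/-! ### Integrability and comparison of means -/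

section Integrability

variable (h : PinningModel κ κ' μ ν β α M C K)
include h

lemma integrable_logFree {T : ℝ} (hT : 0 ≤ T) : Integrable (logFree μ β T) ν := by
  have := h.right.isProbabilityMeasure
  refine Integrable.mono' (integrable_const (β * T)) (h.measurable_logFree T).aestronglyMeasurable
    (Eventually.of_forall fun y => ?_)
  rw [Real.norm_of_nonneg (h.logFree_nonneg y hT)]
  exact h.logFree_le y hT

/-- Short times are allowed, so the bound used is `lower.fixed`, whose constant may depend on `T`,
rather than the uniform `lower.long`. -/
lemma integrable_logPinned {T : ℝ} (hT : 0 < T) : Integrable (logPinned μ β T) ν := by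
  have := h.right.isProbabilityMeasure
  obtain ⟨A, hA⟩ := h.lower.fixed T hT
  refine Integrable.mono' (((integrable_const (β * T)).add (integrable_const |A|)).add
    ((integrable_logMax h.alpha_pos h.right h.moment hT.le).const_mul 4))
    (h.measurable_logPinned T).aestronglyMeasurable ?_
  filter_upwards [ae_maxPow_ne_top h.right h.moment hT.le] with y hy
  have h1 := log_one_add_abs_le h.alpha_pos h.alpha_le_one hy (le_refl T)
  have h2 := h.log_kernel_le_logPinned y hT
  have h3 := hA (y T)
  have h4 := h.logPinned_le_logFree y hT
  have h5 := h.logFree_le y hT.le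
  have h6 := logMax_nonneg h.alpha_pos T y
  have h7 := mul_nonneg h.beta_nonneg hT.le
  simp only [Pi.add_apply]
  rw [Real.norm_eq_abs, abs_le]
  constructor <;> linarith [neg_abs_le A, le_abs_self A]

lemma integral_logFree_nonneg {T : ℝ} (hT : 0 ≤ T) : 0 ≤ ∫ y, logFree μ β T y ∂ν :=
  integral_nonneg fun y => h.logFree_nonneg y hT

/-- Integrated form of `logFree_shift_le`: stationarity of the increments of `y` removes the shift
by 1, and `integral_logMax_le` makes the error logarithmic. -/
lemma exists_integral_logFree_le : ∃ A B : ℝ, ∀ T : ℝ, 0 ≤ T →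
    ∫ y, logFree μ β T y ∂ν ≤ ∫ y, logPinned μ β (T + 2) y ∂ν + (A + B * Real.log (T + 3)) := by
  have := h.right.isProbabilityMeasure
  refine ⟨2 * Real.log (1 + β) + 2 * (C + 8 * (M / α)), 2 + 2 * (K + 8 / α), fun T hT => ?_⟩
  have hT2 : 0 ≤ T + 2 := by linarith
  have hβ := h.beta_nonneg
  have hα := h.alpha_pos
  have hi := integrable_logMax h.alpha_pos h.right h.moment hT2
  have hip := h.integrable_logPinned (by linarith : 0 < T + 2)
  have hmp := h.right.measurePreserving_shift zero_le_one
  have e1 : ∫ y, logFree μ β T y ∂ν = ∫ y, logFree μ β T (shift 1 y) ∂ν := by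
    rw [← integral_map (measurable_shift 1).aemeasurable
      (h.measurable_logFree T).aestronglyMeasurable, hmp.map_eq]
  have i1 : Integrable (fun y => logPinned μ β (T + 2) y + 2 * Real.log (1 + β * T)) ν :=
    hip.add (integrable_const _)
  have i2 : Integrable (fun y => C + K * Real.log (T + 2) + 8 * logMax α (T + 2) y) ν :=
    (integrable_const _).add (hi.const_mul 8)
  have hi2 : Integrable (fun y => logPinned μ β (T + 2) y + 2 * Real.log (1 + β * T) +
      2 * (C + K * Real.log (T + 2) + 8 * logMax α (T + 2) y)) ν := i1.add (i2.const_mul 2)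
  have e2 : ∫ y, logFree μ β T (shift 1 y) ∂ν ≤
      ∫ y, (logPinned μ β (T + 2) y + 2 * Real.log (1 + β * T) +
      2 * (C + K * Real.log (T + 2) + 8 * logMax α (T + 2) y)) ∂ν := by
    refine integral_mono_ae (hmp.integrable_comp_of_integrable (h.integrable_logFree hT)) hi2 ?_
    filter_upwards [ae_maxPow_ne_top h.right h.moment hT2] with y hy
    exact h.logFree_shift_le hT hy
  have e3 : ∫ y, (logPinned μ β (T + 2) y + 2 * Real.log (1 + β * T) +
      2 * (C + K * Real.log (T + 2) + 8 * logMax α (T + 2) y)) ∂ν =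
      ∫ y, logPinned μ β (T + 2) y ∂ν + 2 * Real.log (1 + β * T) +
      2 * (C + K * Real.log (T + 2) + 8 * ∫ y, logMax α (T + 2) y ∂ν) := by
    rw [integral_add i1 (i2.const_mul 2), integral_add hip (integrable_const _), integral_const_mul, integral_const_mul,
      integral_add (integrable_const _) (hi.const_mul 8), integral_const_mul]
    simp
  have e4 := integral_logMax_le h.alpha_pos h.right h.moment hT2
  have e5 : Real.log (1 + β * T) ≤ Real.log (1 + β) + Real.log (T + 3) := by
    rw [← Real.log_mul (by positivity) (by positivity)]
    refine Real.log_le_log (by positivity) ?_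
    nlinarith
  have e6 : K * Real.log (T + 2) ≤ K * Real.log (T + 3) :=
    mul_le_mul_of_nonneg_left (Real.log_le_log (by linarith) (by linarith)) h.lower.nonneg
  rw [show 1 + (T + 2) = T + 3 by ring, add_div] at e4
  have e7 : 8 / α * Real.log (T + 3) = 8 * (Real.log (T + 3) / α) := by ring
  have e8 : (2 + 2 * (K + 8 / α)) * Real.log (T + 3) = 2 * Real.log (T + 3) +
      2 * (K * Real.log (T + 3)) + 2 * (8 / α * Real.log (T + 3)) := by ring
  rw [e1]
  refine e2.trans ?_
  rw [e3, e8, e7]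
  linarith

end Integrability

end PinningModel

/-! ### Block averages and existence of the limit -/

/-- The law of large numbers for a function of successive blocks of a walk. -/
lemma IsWalkLaw.tendsto_block_average {κ : ℝ → ℤ → ℝ} {ν : Measure Traj} (h : IsWalkLaw κ ν)
    {k : ℝ} (hk : 0 ≤ k) {f : Traj → ℝ} (hf : Measurable f) (hfi : Integrable f ν)
    (hfk : ∀ y, f (stopAt k y) = f y) :
    ∀ᵐ y ∂ν, Tendsto (fun n : ℕ => (∑ j ∈ Finset.range n, f (shift (j * k) y)) / n) atTop
      (𝓝 (∫ y, f y ∂ν)) := by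
  have hmp : ∀ j : ℕ, MeasurePreserving (shift (j * k)) ν ν := fun j =>
    h.measurePreserving_shift (by positivity)
  have h0 : (fun y => f (shift ((0 : ℕ) * k) y)) = f := by
    funext y; simp [shift_zero]
  have hlt : ∀ i j : ℕ, i < j →
      IndepFun (fun y => f (shift (i * k) y)) (fun y => f (shift (j * k) y)) ν := by
    intro i j hij
    have hij' : (i + 1 : ℝ) ≤ j := by exact_mod_cast hij
    have hle : i * k + k ≤ j * k := by nlinarith
    have e := (h.indepFun (j * k) (by positivity)).comp
      (hf.comp (measurable_shift (i * k))) hf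
    -- Block `i` ends at `(i + 1) k ≤ j k`, so stopping at `j k` does not change it: it belongs to
    -- the past of block `j`.
    have e' : (f ∘ shift (i * k)) ∘ stopAt (j * k) = fun y => f (shift (i * k) y) := by
      funext y
      simp only [Function.comp]
      rw [← hfk, stopAt_shift hk, stopAt_stopAt hle, ← stopAt_shift hk, hfk]
    rw [e'] at e
    exact e
  have := strong_law_ae_real (μ := ν) (fun (j : ℕ) y => f (shift (j * k) y))
    (by rw [h0]; exact hfi) (fun i j hij => by
      rcases lt_or_gt_of_ne hij with hlt' | hlt'
      · exact hlt i j hlt'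
      · exact (hlt j i hlt').symm)
    (fun i => by
      rw [h0]
      refine ⟨(hf.comp (measurable_shift _)).aemeasurable, hf.aemeasurable, ?_⟩
      change ν.map (f ∘ shift (i * k)) = ν.map f
      rw [← Measure.map_map hf (measurable_shift _), (hmp i).map_eq])
  rwa [h0] at this

lemma tendsto_inv_mul_log_add (a : ℝ) (ha : 0 ≤ a) (A B : ℝ) :
    Tendsto (fun T : ℝ => T⁻¹ * (A + B * Real.log (T + a))) atTop (𝓝 0) := by
  have h1 : Tendsto (fun T : ℝ => Real.log (T + a) / (T + a)) atTop (𝓝 0) :=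
    Real.isLittleO_log_id_atTop.tendsto_div_nhds_zero.comp (tendsto_atTop_add_const_right _ a
      tendsto_id)
  have h2 : Tendsto (fun T : ℝ => 1 + a * T⁻¹) atTop (𝓝 (1 + a * 0)) :=
    tendsto_const_nhds.add (tendsto_inv_atTop_zero.const_mul a)
  have h3 := (tendsto_inv_atTop_zero.const_mul A).add ((h1.mul h2).const_mul B)
  simp only [mul_zero, add_zero, zero_mul] at h3
  refine h3.congr' ?_
  filter_upwards [eventually_gt_atTop 0] with T hT
  have : T + a ≠ 0 := by positivity
  field_simp

namespace PinningModel

variable {κ κ' : ℝ → ℤ → ℝ} {μ ν : Measure Traj} {β α : ℝ} {M : ℝ≥0} {C K : ℝ}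

/-- The free energy, as an infimum. -/
def freeEnergy (μ ν : Measure Traj) (β : ℝ) : ℝ :=
  ⨅ T : Set.Ici (1 : ℝ), (T : ℝ)⁻¹ * ∫ y, logFree μ β T y ∂ν

variable (h : PinningModel κ κ' μ ν β α M C K)
include h

lemma freeEnergy_nonneg : 0 ≤ freeEnergy μ ν β :=
  Real.iInf_nonneg fun T => by
    have hT : (0 : ℝ) ≤ T := zero_le_one.trans T.2
    exact mul_nonneg (inv_nonneg.2 hT) (h.integral_logFree_nonneg hT)

/-- Full blocks obey the law of large numbers; the incomplete last block contributes at most `β k`,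
which disappears after division by `T`. -/
lemma ae_limsup_le {k : ℝ} (hk : 0 < k) : ∀ᵐ y ∂ν, ∀ r, k⁻¹ * ∫ y, logFree μ β k y ∂ν < r →
    ∀ᶠ T in atTop, T⁻¹ * logFree μ β T y < r := by
  filter_upwards [h.right.tendsto_block_average hk.le (h.measurable_logFree k)
    (h.integrable_logFree hk.le) (logFree_stopAt μ β hk.le)] with y hy r hr
  set m := ∫ y, logFree μ β k y ∂ν
  set S : ℕ → ℝ := fun n => ∑ j ∈ Finset.range n, logFree μ β k (shift (j * k) y) with hS
  have hfl : Tendsto (fun T : ℝ => (⌊k⁻¹ * T⌋₊ : ℝ) / T) atTop (𝓝 k⁻¹) :=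
    tendsto_nat_floor_mul_div_atTop (inv_nonneg.2 hk.le)
  have hfl' : Tendsto (fun T : ℝ => ⌊k⁻¹ * T⌋₊) atTop atTop :=
    tendsto_nat_floor_atTop.comp (tendsto_id.const_mul_atTop (inv_pos.2 hk))
  have h1 := ((hy.comp hfl').mul hfl).add (tendsto_inv_atTop_zero.mul_const (β * k))
  rw [zero_mul, add_zero, mul_comm m] at h1
  filter_upwards [h1.eventually (gt_mem_nhds hr), eventually_gt_atTop 0,
    hfl'.eventually (eventually_gt_atTop 0)] with T hT hT0 hn0
  refine lt_of_le_of_lt ?_ hT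
  set n := ⌊k⁻¹ * T⌋₊ with hn
  have hnk : n * k ≤ T := by
    have := Nat.floor_le (a := k⁻¹ * T) (by positivity)
    rwa [← hn, ← div_eq_inv_mul, le_div_iff₀ hk] at this
  have hnk' : T - n * k ≤ k := by
    have := (Nat.lt_floor_add_one (k⁻¹ * T)).le
    rw [← hn, ← div_eq_inv_mul, div_le_iff₀ hk] at this
    linarith
  have e1 := h.logFree_add_le y (by positivity : 0 ≤ n * k) (sub_nonneg.2 hnk)
  rw [add_sub_cancel] at e1
  have e2 := h.logFree_mul_le y hk.le n
  have e3 := h.logFree_le (shift (n * k) y) (sub_nonneg.2 hnk)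
  have e4 : β * (T - n * k) ≤ β * k := mul_le_mul_of_nonneg_left hnk' h.beta_nonneg
  have hn0' : (n : ℝ) ≠ 0 := by exact_mod_cast hn0.ne'
  calc T⁻¹ * logFree μ β T y ≤ T⁻¹ * (S n + β * k) := by
        gcongr
        simp only [hS]
        linarith
    _ = S n / n * (n / T) + T⁻¹ * (β * k) := by field_simp

/-- Here the last piece has no deterministic lower bound; it is controlled by `logMax`, which is
`o(T)` almost surely. -/
lemma ae_le_liminf {k : ℝ} (hk : 1 ≤ k) : ∀ᵐ y ∂ν, ∀ r, r < k⁻¹ * ∫ y, logPinned μ β k y ∂ν →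
    ∀ᶠ T in atTop, r < T⁻¹ * logPinned μ β T y := by
  have hk0 : 0 < k := by linarith
  -- One null set must serve all real `T`: integer horizons suffice, as the maximum up to `⌈T⌉₊`
  -- dominates.
  have hfin : ∀ᵐ y ∂ν, ∀ n : ℕ, maxPow α n y ≠ ∞ :=
    ae_all_iff.2 fun n => ae_maxPow_ne_top h.right h.moment (Nat.cast_nonneg n)
  filter_upwards [h.right.tendsto_block_average hk0.le (h.measurable_logPinned k)
    (h.integrable_logPinned hk0) (logPinned_stopAt μ β hk0.le), hfin,
    ae_tendsto_logMax h.alpha_pos h.right h.moment] with y hy hfin hlog r hr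
  set m := ∫ y, logPinned μ β k y ∂ν
  set S : ℕ → ℝ := fun n => ∑ j ∈ Finset.range n, logPinned μ β k (shift (j * k) y) with hS
  have hfl : Tendsto (fun T : ℝ => (⌊k⁻¹ * T⌋₊ : ℝ) / T) atTop (𝓝 k⁻¹) :=
    tendsto_nat_floor_mul_div_atTop (inv_nonneg.2 hk0.le)
  have hfl' : Tendsto (fun T : ℝ => ⌊k⁻¹ * T⌋₊) atTop atTop :=
    tendsto_nat_floor_atTop.comp (tendsto_id.const_mul_atTop (inv_pos.2 hk0))
  have hfl1 : Tendsto (fun T : ℝ => ⌊k⁻¹ * T⌋₊ - 1) atTop atTop :=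
    (tendsto_sub_atTop_nat 1).comp hfl'
  have hcl : Tendsto (fun T : ℝ => (⌈T⌉₊ : ℝ) / T) atTop (𝓝 1) := by
    simpa using tendsto_nat_ceil_mul_div_atTop (R := ℝ) zero_le_one
  have hmax := (hlog.comp tendsto_nat_ceil_atTop).mul hcl
  have h1 := ((hy.comp hfl1).mul (hfl.sub tendsto_inv_atTop_zero)).sub
    ((tendsto_inv_atTop_zero.mul_const (C + K * Real.log (2 * k))).add (hmax.const_mul 8))
  simp only [sub_zero, zero_mul, mul_zero, add_zero] at h1
  rw [mul_comm m] at h1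
  filter_upwards [h1.eventually (lt_mem_nhds hr), eventually_gt_atTop 0,
    hfl'.eventually (eventually_gt_atTop 1)] with T hT hT0 hn0
  refine lt_of_lt_of_le hT ?_
  set n := ⌊k⁻¹ * T⌋₊ with hn
  -- Only `n - 1 = p + 1` blocks are used, so the last piece has length between `k` and `2 k`, in
  -- particular at least 1.
  obtain ⟨p, hp⟩ : ∃ p : ℕ, n = p + 2 := ⟨n - 2, by omega⟩
  have hnk : n * k ≤ T := by
    have := Nat.floor_le (a := k⁻¹ * T) (by positivity)
    rwa [← hn, ← div_eq_inv_mul, le_div_iff₀ hk0] at this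
  have hnk' : T ≤ (n + 1) * k := by
    have := (Nat.lt_floor_add_one (k⁻¹ * T)).le
    rwa [← hn, ← div_eq_inv_mul, div_le_iff₀ hk0] at this
  have hpn : (n : ℝ) = p + 2 := by rw [hp]; push_cast; ring
  have ht1 : k ≤ T - (p + 1 : ℕ) * k := by push_cast; rw [hpn] at hnk; nlinarith
  have ht2 : T - (p + 1 : ℕ) * k ≤ 2 * k := by push_cast; rw [hpn] at hnk'; nlinarith
  have hTc : T ≤ ⌈T⌉₊ := Nat.le_ceil T
  have e1 := h.logPinned_add_le y (by positivity : 0 < ((p + 1 : ℕ) : ℝ) * k)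
    (by linarith : 0 < T - (p + 1 : ℕ) * k)
  rw [add_sub_cancel] at e1
  have e2 := h.sum_le_logPinned_mul y hk0 p
  have e3 := h.logPinned_shift_ge (hfin ⌈T⌉₊) (s := (p + 1 : ℕ) * k)
    (t := T - (p + 1 : ℕ) * k) (by linarith) (by linarith) (by linarith) ht2
  have hp0 : ((p + 1 : ℕ) : ℝ) ≠ 0 := by positivity
  have hc0 : (⌈T⌉₊ : ℝ) ≠ 0 := by
    have := Nat.ceil_pos.2 hT0
    positivity
  calc _ = T⁻¹ * (S (p + 1) - (C + K * Real.log (2 * k) + 8 * logMax α ⌈T⌉₊ y)) := by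
        simp only [Function.comp]
        rw [← hn, show n - 1 = p + 1 by omega, show (n : ℝ) = (p + 1 : ℕ) + 1 by
          rw [hpn]; push_cast; ring]
        field_simp
        ring
    _ ≤ _ := by
        gcongr
        simp only [hS]
        linarith

/-- The block lengths `k` and `k'` are unrelated, so the comparison goes through a typical path:
otherwise `logPinned` would exceed `logFree` on it for large `T`. -/
lemma integral_logPinned_le_integral_logFree {k k' : ℝ} (hk : 1 ≤ k) (hk' : 0 < k') :
    k⁻¹ * ∫ y, logPinned μ β k y ∂ν ≤ k'⁻¹ * ∫ y, logFree μ β k' y ∂ν := by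
  have := h.right.isProbabilityMeasure
  by_contra! hlt
  obtain ⟨r, hr1, hr2⟩ := exists_between hlt
  obtain ⟨y, hy1, hy2⟩ := ((h.ae_limsup_le hk').and (h.ae_le_liminf hk)).exists
  obtain ⟨T, hT1, hT2, hT0⟩ := ((hy1 r hr1).and ((hy2 r hr2).and (eventually_gt_atTop 0))).exists
  have := mul_le_mul_of_nonneg_left (h.logPinned_le_logFree y hT0) (inv_nonneg.2 hT0.le)
  linarith

lemma freeEnergy_le {T : ℝ} (hT : 1 ≤ T) :
    freeEnergy μ ν β ≤ T⁻¹ * ∫ y, logFree μ β T y ∂ν := by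
  refine ciInf_le (f := fun T : Set.Ici (1 : ℝ) => (T : ℝ)⁻¹ * ∫ y, logFree μ β T y ∂ν)
    ⟨0, ?_⟩ ⟨T, hT⟩
  rintro _ ⟨T, rfl⟩
  have hT : (0 : ℝ) ≤ T := zero_le_one.trans T.2
  exact mul_nonneg (inv_nonneg.2 hT) (h.integral_logFree_nonneg hT)

lemma le_freeEnergy {T : ℝ} (hT : 1 ≤ T) :
    T⁻¹ * ∫ y, logPinned μ β T y ∂ν ≤ freeEnergy μ ν β := by
  have : Nonempty (Set.Ici (1 : ℝ)) := ⟨⟨1, Set.self_mem_Ici⟩⟩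
  exact le_ciInf fun S =>
    h.integral_logPinned_le_integral_logFree hT (zero_lt_one.trans_le S.2)

/-- Above, the free mean at `T` is compared with the pinned mean at `T + 2`, which is at most `(T +
2)` times the free energy. -/
lemma tendsto_mean_logFree : Tendsto (fun T : ℝ => T⁻¹ * ∫ y, logFree μ β T y ∂ν) atTop
    (𝓝 (freeEnergy μ ν β)) := by
  obtain ⟨A, B, hAB⟩ := h.exists_integral_logFree_le
  have h1 : Tendsto (fun T : ℝ => (1 + 2 * T⁻¹) * freeEnergy μ ν β +
      T⁻¹ * (A + B * Real.log (T + 3))) atTop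
      (𝓝 ((1 + 2 * 0) * freeEnergy μ ν β + 0)) :=
    ((tendsto_const_nhds.add (tendsto_inv_atTop_zero.const_mul 2)).mul_const _).add
      (tendsto_inv_mul_log_add 3 (by norm_num) A B)
  rw [mul_zero, add_zero, add_zero, one_mul] at h1
  refine tendsto_of_tendsto_of_tendsto_of_le_of_le' tendsto_const_nhds h1 ?_ ?_
  · filter_upwards [eventually_ge_atTop 1] with T hT using h.freeEnergy_le hT
  · filter_upwards [eventually_ge_atTop 1] with T hT
    have hT0 : 0 < T := by linarith
    have e1 := h.le_freeEnergy (by linarith : 1 ≤ T + 2)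
    rw [inv_mul_le_iff₀ (by linarith)] at e1
    calc T⁻¹ * ∫ y, logFree μ β T y ∂ν
        ≤ T⁻¹ * ((T + 2) * freeEnergy μ ν β + (A + B * Real.log (T + 3))) := by
          gcongr
          exact (hAB T hT0.le).trans (by gcongr)
      _ = _ := by field_simp

lemma tendsto_mean_logPinned : Tendsto (fun T : ℝ => T⁻¹ * ∫ y, logPinned μ β T y ∂ν) atTop
    (𝓝 (freeEnergy μ ν β)) := by
  obtain ⟨A, B, hAB⟩ := h.exists_integral_logFree_le
  have h1 : Tendsto (fun T : ℝ => (1 - 2 * T⁻¹) * freeEnergy μ ν β -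
      T⁻¹ * (A + B * Real.log (T + 1))) atTop
      (𝓝 ((1 - 2 * 0) * freeEnergy μ ν β - 0)) :=
    ((tendsto_const_nhds.sub (tendsto_inv_atTop_zero.const_mul 2)).mul_const _).sub
      (tendsto_inv_mul_log_add 1 (by norm_num) A B)
  rw [mul_zero, sub_zero, sub_zero, one_mul] at h1
  refine tendsto_of_tendsto_of_tendsto_of_le_of_le' h1 tendsto_const_nhds ?_ ?_
  · filter_upwards [eventually_ge_atTop 3] with T hT
    have hT0 : 0 < T := by linarith
    have e1 := h.freeEnergy_le (by linarith : 1 ≤ T - 2)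
    rw [le_inv_mul_iff₀ (by linarith)] at e1
    have e2 := hAB (T - 2) (by linarith)
    rw [sub_add_cancel, show T - 2 + 3 = T + 1 by ring] at e2
    calc _ = T⁻¹ * ((T - 2) * freeEnergy μ ν β - (A + B * Real.log (T + 1))) := by
          field_simp
      _ ≤ _ := by
          gcongr
          linarith
  · filter_upwards [eventually_ge_atTop 1] with T hT using h.le_freeEnergy hT

/-- Integer-indexed block lengths keep the exceptional set null; a length good enough for the given
`r` is chosen afterwards from the limits of the means. -/
lemma ae_limits : ∀ᵐ y ∂ν,
    (∀ r, freeEnergy μ ν β < r → ∀ᶠ T in atTop, T⁻¹ * logFree μ β T y < r) ∧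
    ∀ r, r < freeEnergy μ ν β → ∀ᶠ T in atTop, r < T⁻¹ * logPinned μ β T y := by
  have h1 := ae_all_iff.2 fun k : ℕ => h.ae_limsup_le (k := (k : ℝ) + 1) (by positivity)
  have h2 := ae_all_iff.2 fun k : ℕ => h.ae_le_liminf (k := (k : ℝ) + 1)
    (by linarith [Nat.cast_nonneg (α := ℝ) k])
  have hk : Tendsto (fun k : ℕ => (k : ℝ) + 1) atTop atTop :=
    tendsto_atTop_add_const_right _ 1 tendsto_natCast_atTop_atTop
  filter_upwards [h1, h2] with y hy1 hy2
  refine ⟨fun r hr => ?_, fun r hr => ?_⟩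
  · obtain ⟨k, hk⟩ := ((h.tendsto_mean_logFree.comp hk).eventually (gt_mem_nhds hr)).exists
    exact hy1 k r hk
  · obtain ⟨k, hk⟩ := ((h.tendsto_mean_logPinned.comp hk).eventually (lt_mem_nhds hr)).exists
    exact hy2 k r hk

/-- Any family squeezed between the pinned and the free partition functions, up to a constant
factor, has the same free energy. -/
theorem hasFreeEnergy {Z : ℝ → Traj → ℝ} {c : ℝ} (hpos : ∀ T, 0 < T → ∀ y, 0 < Z T y)
    (hm : ∀ T, 0 < T → Measurable (Z T))
    (hlow : ∀ T, 0 < T → ∀ y, c + logPinned μ β T y ≤ Real.log (Z T y))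
    (hupp : ∀ T, 0 < T → ∀ y, Real.log (Z T y) ≤ c + logFree μ β T y) :
    HasFreeEnergy ν Z (freeEnergy μ ν β) := by
  have := h.right.isProbabilityMeasure
  set F := freeEnergy μ ν β with hF
  have hlm : ∀ T, 0 < T → Measurable fun y => Real.log (Z T y) := fun T hT =>
    Real.measurable_log.comp (hm T hT)
  have hint : ∀ T, 0 < T → Integrable (fun y => Real.log (Z T y)) ν := by
    intro T hT
    refine integrable_of_le_of_le (hlm T hT).aestronglyMeasurable
      (Eventually.of_forall (hlow T hT)) (Eventually.of_forall (hupp T hT))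
      ((integrable_const c).add (h.integrable_logPinned hT))
      ((integrable_const c).add (h.integrable_logFree hT.le))
  have hc : Tendsto (fun T : ℝ => T⁻¹ * c) atTop (𝓝 0) := by
    simpa using tendsto_inv_atTop_zero.mul_const c
  have hae : ∀ᵐ y ∂ν, Tendsto (fun T : ℝ => T⁻¹ * Real.log (Z T y)) atTop (𝓝 F) := by
    filter_upwards [h.ae_limits] with y hy
    refine tendsto_order.2 ⟨fun r hr => ?_, fun r hr => ?_⟩
    · obtain ⟨r', hr1, hr2⟩ := exists_between hr
      filter_upwards [hy.2 r' hr2, hc.eventually (lt_mem_nhds (by linarith : r - r' < 0)),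
        eventually_gt_atTop 0] with T h1 h2 hT
      have := mul_le_mul_of_nonneg_left (hlow T hT y) (inv_nonneg.2 hT.le)
      rw [mul_add] at this
      linarith
    · obtain ⟨r', hr1, hr2⟩ := exists_between hr
      filter_upwards [hy.1 r' hr1, hc.eventually (gt_mem_nhds (by linarith : 0 < r - r')),
        eventually_gt_atTop 0] with T h1 h2 hT
      have := mul_le_mul_of_nonneg_left (hupp T hT y) (inv_nonneg.2 hT.le)
      rw [mul_add] at this
      linarith
  have hmean : Tendsto (fun T : ℝ => T⁻¹ * ∫ y, Real.log (Z T y) ∂ν) atTop (𝓝 F) := by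
    have t1 := hc.add h.tendsto_mean_logPinned
    have t2 := hc.add h.tendsto_mean_logFree
    rw [zero_add] at t1 t2
    refine tendsto_of_tendsto_of_tendsto_of_le_of_le' t1 t2 ?_ ?_
    · filter_upwards [eventually_gt_atTop 0] with T hT
      rw [← mul_add]
      gcongr
      have := integral_mono ((integrable_const c).add (h.integrable_logPinned hT)) (hint T hT)
        (hlow T hT)
      simp only [Pi.add_apply] at this
      rw [integral_add (integrable_const c) (h.integrable_logPinned hT)] at this
      simpa using this
    · filter_upwards [eventually_gt_atTop 0] with T hT
      rw [← mul_add]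
      gcongr
      have := integral_mono (hint T hT) ((integrable_const c).add (h.integrable_logFree hT.le))
        (hupp T hT)
      simp only [Pi.add_apply] at this
      rw [integral_add (integrable_const c) (h.integrable_logFree hT.le)] at this
      simpa using this
  refine ⟨hpos, hint, hae, ?_, hmean⟩
  -- Scheffé's argument: the positive part is bounded by `β + |c|` for `T ≥ 1`, because `logFree` is
  -- at most `β T` and `F ≥ 0`. With `|f| = 2 f⁺ - f`, dominated convergence and the limit of the
  -- means give `L¹` convergence.
  have hplus : Tendsto (fun T : ℝ => ∫ y, max (T⁻¹ * Real.log (Z T y) - F) 0 ∂ν) atTop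
      (𝓝 (∫ _, 0 ∂ν)) := by
    refine tendsto_integral_filter_of_dominated_convergence (fun _ => β + |c|) ?_ ?_
      (integrable_const _) ?_
    · filter_upwards [eventually_gt_atTop 0] with T hT
      exact ((((hlm T hT).const_mul _).sub_const F).max measurable_const).aestronglyMeasurable
    · filter_upwards [eventually_ge_atTop 1] with T hT
      refine Eventually.of_forall fun y => ?_
      have hT0 : 0 < T := by linarith
      rw [Real.norm_of_nonneg (le_max_right _ _)]
      refine max_le ?_ (add_nonneg h.beta_nonneg (abs_nonneg c))
      have e1 := (hupp T hT0 y).trans (add_le_add_right (h.logFree_le y hT0.le) c)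
      have e2 : T⁻¹ * Real.log (Z T y) ≤ β + |c| := by
        rw [inv_mul_le_iff₀ hT0]
        nlinarith [le_abs_self c, abs_nonneg c]
      linarith [h.freeEnergy_nonneg]
    · filter_upwards [hae] with y hy
      have := (hy.sub_const F).max (tendsto_const_nhds (x := (0 : ℝ)))
      simpa using this
  rw [integral_zero] at hplus
  have hL := (hplus.const_mul 2).sub (hmean.sub_const F)
  rw [mul_zero, sub_self, sub_zero] at hL
  refine hL.congr' ?_
  filter_upwards [eventually_gt_atTop 0] with T hT
  have i1 : Integrable (fun y => T⁻¹ * Real.log (Z T y) - F) ν :=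
    ((hint T hT).const_mul _).sub (integrable_const F)
  have i2 : Integrable (fun y => max (T⁻¹ * Real.log (Z T y) - F) 0) ν := i1.pos_part
  have e : ∀ y, |T⁻¹ * Real.log (Z T y) - F| = 2 * max (T⁻¹ * Real.log (Z T y) - F) 0 -
      (T⁻¹ * Real.log (Z T y) - F) := by
    intro y
    rcases le_total 0 (T⁻¹ * Real.log (Z T y) - F) with h0 | h0
    · rw [abs_of_nonneg h0, max_eq_left h0]; ring
    · rw [abs_of_nonpos h0, max_eq_right h0]; ring
  simp_rw [e]
  rw [integral_sub (i2.const_mul 2) i1, integral_const_mul,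
    integral_sub ((hint T hT).const_mul _) (integrable_const F), integral_const_mul]
  simp

end PinningModel

/-! ### Transfer to walks on arbitrary probability spaces -/

lemma HasFreeEnergy.comp {Ω Ω' : Type*} [MeasurableSpace Ω] [MeasurableSpace Ω'] {Q : Measure Ω}
    {Q' : Measure Ω'} {Z : ℝ → Ω' → ℝ} {F : ℝ} (hZ : HasFreeEnergy Q' Z F) {V : Ω → Ω'}
    (hV : MeasurePreserving V Q Q') [IsFiniteMeasure Q'] :
    HasFreeEnergy Q (fun T ω => Z T (V ω)) F := by
  have hmap : ∀ f : Ω' → ℝ, AEStronglyMeasurable f Q' → ∫ ω, f (V ω) ∂Q = ∫ ω, f ω ∂Q' := by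
    intro f hf
    rw [← hV.map_eq] at hf ⊢
    exact (integral_map hV.aemeasurable hf).symm
  have hlog : ∀ T, 0 < T → AEStronglyMeasurable (fun ω => Real.log (Z T ω)) Q' := fun T hT =>
    (hZ.integrable_log T hT).aestronglyMeasurable
  refine ⟨fun T hT ω => hZ.pos T hT _, fun T hT =>
    hV.integrable_comp_of_integrable (hZ.integrable_log T hT),
    hV.quasiMeasurePreserving.ae hZ.tendsto_ae, hZ.tendsto_L1.congr' ?_,
    hZ.tendsto_mean.congr' ?_⟩
  · filter_upwards [eventually_gt_atTop 0] with T hT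
    exact (hmap (fun ω => |T⁻¹ * Real.log (Z T ω) - F|)
      (((hlog T hT).const_mul _).sub aestronglyMeasurable_const).norm).symm
  · filter_upwards [eventually_gt_atTop 0] with T hT
    rw [hmap _ (hlog T hT)]

namespace IsRandomWalk

variable {Ω : Type*} [MeasurableSpace Ω] {J : ℤ → ℝ} {W : ℝ≥0 → Ω → ℤ} {P : Measure Ω}

lemma overlap_traj (hW : IsRandomWalk J W P) {r : ℝ} (hr : 0 ≤ r) (ω : Ω) (y : Traj) (T : ℝ) :
    overlap (fun t => slowed r W t ω) y T = energy 0 (hW.traj hr ω) y T := by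
  unfold overlap energy meet
  simp only [zero_add]
  rfl

lemma measurable_exp_energy (hW : IsRandomWalk J W P) {r : ℝ} (hr : 0 ≤ r) (β : ℝ) (y : Traj)
    (T : ℝ) : Measurable fun ω => Real.exp (β * energy 0 (hW.traj hr ω) y T) :=
  Real.measurable_exp.comp
    (((measurable_energy 0 y T).comp (hW.measurable_traj hr)).const_mul β)

lemma freePartition_eq (hW : IsRandomWalk J W P) {r : ℝ} (hr : 0 ≤ r) (β : ℝ) (y : Traj)
    (T : ℝ) : freePartition P (slowed r W) β y T =
      (free (P.map (hW.traj hr)) β 0 y T).toReal := by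
  have hm := hW.measurable_traj hr
  unfold freePartition
  simp_rw [hW.overlap_traj hr]
  rw [integral_eq_lintegral_of_nonneg_ae (Eventually.of_forall fun ω => Real.exp_nonneg _)
    (hW.measurable_exp_energy hr β y T).aestronglyMeasurable, free,
    lintegral_map (measurable_weight β 0 y T) hm]
  rfl

lemma constrainedPartition_eq (hW : IsRandomWalk J W P) {r : ℝ} (hr : 0 ≤ r) (β : ℝ) (y : Traj)
    (T : ℝ) : constrainedPartition P (slowed r W) β y T =
      β * (pinned (P.map (hW.traj hr)) β y T).toReal := by
  have hm := hW.measurable_traj hr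
  unfold constrainedPartition
  simp_rw [hW.overlap_traj hr]
  have hm2 : Measurable fun ω => if slowed r W T ω = y T then (1 : ℝ) else 0 :=
    Measurable.ite (measurableSet_eq_fun (hW.measurable _) measurable_const) measurable_const
      measurable_const
  rw [integral_eq_lintegral_of_nonneg_ae (Eventually.of_forall fun ω =>
      mul_nonneg (Real.exp_nonneg _) (by split_ifs <;> norm_num))
    ((hW.measurable_exp_energy hr β y T).mul hm2).aestronglyMeasurable, pinned,
    lintegral_map (measurable_pinnedWeight β y T) hm]
  congr 2
  refine lintegral_congr fun ω => ?_
  rw [ENNReal.ofReal_mul (Real.exp_nonneg _), pinnedWeight, weight]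
  congr 1
  change ENNReal.ofReal (if slowed r W T ω = y T then 1 else 0) =
    if slowed r W T ω = y T then 1 else 0
  split_ifs <;> simp

end IsRandomWalk

namespace PinningModel

variable {κ κ' : ℝ → ℤ → ℝ} {μ ν : Measure Traj} {β α : ℝ} {M : ℝ≥0} {C K : ℝ}

lemma hasFreeEnergy_free (h : PinningModel κ κ' μ ν β α M C K) :
    HasFreeEnergy ν (fun T y => (free μ β 0 y T).toReal) (freeEnergy μ ν β) := by
  have := h.left.isProbabilityMeasure
  refine h.hasFreeEnergy (c := 0)
    (fun T hT y => zero_lt_one.trans_le (h.one_le_toReal_free y hT.le))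
    (fun T _ => (measurable_free μ β 0 T).ennreal_toReal) (fun T hT y => ?_) fun T hT y => ?_
  · simpa using h.logPinned_le_log_free y hT
  · simpa using h.log_free_le_logFree y hT.le

lemma hasFreeEnergy_pinned (h : PinningModel κ κ' μ ν β α M C K) (hβ : 0 < β) :
    HasFreeEnergy ν (fun T y => β * (pinned μ β y T).toReal) (freeEnergy μ ν β) := by
  have := h.left.isProbabilityMeasure
  have hlog : ∀ T, 0 < T → ∀ y, Real.log (β * (pinned μ β y T).toReal) =
      Real.log β + logPinned μ β T y := fun T hT y =>
    Real.log_mul hβ.ne' (h.toReal_pinned_pos y hT).ne'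
  refine h.hasFreeEnergy (c := Real.log β) (fun T hT y => mul_pos hβ (h.toReal_pinned_pos y hT))
    (fun T _ => (measurable_pinned μ β T).ennreal_toReal.const_mul β)
    (fun T hT y => (hlog T hT y).ge) fun T hT y => ?_
  rw [hlog T hT y]
  gcongr
  exact h.logPinned_le_logFree y hT

end PinningModel

end RWPM

end

/-- Existence of the quenched free energy of the random walk pinning model for `γ`-stable walks.
`F` depends only on the kernel `J` and on `ρ`, `β`. The walks `X_t = W¹_{(1-ρ)t}` and
`Y_t = W²_{ρt}` are independent since they live on the two factors of `(Ω₁, P) × (Ω₂, Q)`. -/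
theorem proposition1p1 (γ : ℝ) (hγ₀ : 0 < γ) (hγ₂ : γ < 2)
    (J : ℤ → ℝ) (hJ : RWPM.IsStableKernel γ J)
    (ρ : ℝ) (hρ₀ : 0 ≤ ρ) (hρ₁ : ρ < 1) (β : ℝ) (hβ : 0 ≤ β) :
    ∃ F : ℝ, 0 ≤ F ∧
      ∀ (Ω₁ Ω₂ : Type*) [MeasurableSpace Ω₁] [MeasurableSpace Ω₂]
        (P : Measure Ω₁) (Q : Measure Ω₂) [IsProbabilityMeasure P] [IsProbabilityMeasure Q]
        (W₁ : ℝ≥0 → Ω₁ → ℤ) (W₂ : ℝ≥0 → Ω₂ → ℤ),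
        RWPM.IsRandomWalk J W₁ P → RWPM.IsRandomWalk J W₂ Q →
        RWPM.HasFreeEnergy Q
          (fun T ω => RWPM.freePartition P (RWPM.slowed (1 - ρ) W₁) β
            (fun t => RWPM.slowed ρ W₂ t ω) T) F ∧
        (0 < β → RWPM.HasFreeEnergy Q
          (fun T ω => RWPM.constrainedPartition P (RWPM.slowed (1 - ρ) W₁) β
            (fun t => RWPM.slowed ρ W₂ t ω) T) F) := by
  have hr : 0 < 1 - ρ := by linarith
  obtain ⟨M, hM⟩ := hJ.exists_momentBound hγ₀ hγ₂
  -- The constant has to be chosen before the walks are given: any pair of walk laws with these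
  -- transition probabilities defines it, and `IsWalkLaw.unique` later identifies them with the laws
  -- of the given walks.
  by_cases hex : ∃ μ ν : Measure RWPM.Traj,
      RWPM.IsWalkLaw (fun t => RWPM.transitionProb J ((1 - ρ) * t)) μ ∧
      RWPM.IsWalkLaw (fun t => RWPM.transitionProb J (ρ * t)) ν
  · obtain ⟨μ, ν, hμ, hν⟩ := hex
    obtain ⟨C, K, hCK⟩ := RWPM.exists_kernelLowerBound hJ hγ₂ hr (by linarith : 0 < γ / 4)
      (hM _ hr.le (by linarith)) hμ
    have h : RWPM.PinningModel _ _ μ ν β (γ / 4) M C K :=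
      ⟨hμ, hν, hβ, by linarith, by linarith, hCK, hM ρ hρ₀ hρ₁.le⟩
    refine ⟨RWPM.PinningModel.freeEnergy μ ν β, h.freeEnergy_nonneg, ?_⟩
    intro Ω₁ Ω₂ _ _ P Q _ _ W₁ W₂ hW₁ hW₂
    have := hν.isProbabilityMeasure
    have e₁ : P.map (hW₁.traj hr.le) = μ := (hW₁.isWalkLaw hr.le).unique hμ
    have hV : MeasurePreserving (hW₂.traj hρ₀) Q ν :=
      ⟨hW₂.measurable_traj hρ₀, (hW₂.isWalkLaw hρ₀).unique hν⟩
    refine ⟨?_, fun hβ' => ?_⟩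
    · have := h.hasFreeEnergy_free.comp hV
      simp_rw [← e₁, ← hW₁.freePartition_eq hr.le] at this
      rw [e₁] at this
      exact this
    · have := (h.hasFreeEnergy_pinned hβ').comp hV
      simp_rw [← e₁, ← hW₁.constrainedPartition_eq hr.le] at this
      rw [e₁] at this
      exact this
  -- Given walks would induce such a pair of laws, so here the claim is vacuous and the value 0 is
  -- arbitrary.
  · refine ⟨0, le_rfl, ?_⟩
    intro Ω₁ Ω₂ _ _ P Q _ _ W₁ W₂ hW₁ hW₂
    exact absurd ⟨_, _, hW₁.isWalkLaw hr.le, hW₂.isWalkLaw hρ₀⟩ hex
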